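/- Let $S_{2,4}$ be the graph obtained from an edge $xy$ by attaching $2$ new pendant vertices to $x$ and $4$ new pendant vertices to $y$ (so it has $8$ vertices and $7$ edges). For a subgraph $H$ of a finite simple graph $G$ let its weight be $w(H)=e(H)+\tfrac12 e[H,G\setminus H]$, where $e(H)$ is the number of edges of $H$ and $e[H,G\setminus H]$ is the number of edges of $G$ with one end in $V(H)$ and the other in $V(G)\setminus V(H)$. Let $G$ be a planar graph on $n$ vertices that does not contain $S_{2,4}$ as a (not necessarily induced) subgraph, and suppose that every vertex of $G$ has degree at least $3$. Then $$e(G)=w(G)\le \frac{31}{14}\,n .$$ -/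

import Mathlib

namespace SimpleGraph

/-- The double star `S_{k,l}`: an edge joining two centres (the two vertices `none`), together with
`k` leaves attached to the first centre and `l` leaves attached to the second one. -/
def doubleStar (k l : ℕ) : SimpleGraph (Option (Fin k) ⊕ Option (Fin l)) :=
  (starGraph (none : Option (Fin k)) ⊕g starGraph (none : Option (Fin l))) ⊔
    edge (Sum.inl none) (Sum.inr none)

/-- `C` is a simple arc in the plane with ends `x` and `y`. -/
def IsPlaneArc (C : Set (EuclideanSpace ℝ (Fin 2))) (x y : EuclideanSpace ℝ (Fin 2)) : Prop :=
  ∃ γ : _root_.Path x y, Function.Injective γ ∧ Set.range γ = C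

/-- A plane drawing of `G` without crossings: the vertices are distinct points, every edge is a
simple arc between its ends that passes through no other vertex, and two distinct edges meet only in
common ends. The value of `curve` on non-edges is irrelevant. -/
structure PlaneEmbedding {V : Type*} (G : SimpleGraph V) where
  /-- the point that represents a vertex -/
  point : V → EuclideanSpace ℝ (Fin 2)
  /-- the arc that represents an edge -/
  curve : Sym2 V → Set (EuclideanSpace ℝ (Fin 2))
  point_injective : Function.Injective point
  isPlaneArc : ∀ u v : V, G.Adj u v → IsPlaneArc (curve s(u, v)) (point u) (point v)
  mem_of_point_mem : ∀ e ∈ G.edgeSet, ∀ w : V, point w ∈ curve e → w ∈ e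
  inter_subset : ∀ e ∈ G.edgeSet, ∀ f ∈ G.edgeSet, e ≠ f →
    curve e ∩ curve f ⊆ point '' {w | w ∈ e ∧ w ∈ f}

/-- `G` is planar: it can be drawn in the plane without crossings. -/
def IsPlanar {V : Type*} (G : SimpleGraph V) : Prop :=
  Nonempty (PlaneEmbedding G)

/-- The edges of `G` with one end in `H` and the other end outside `H`. -/
def Subgraph.leavingEdges {V : Type*} {G : SimpleGraph V} (H : G.Subgraph) : Set (Sym2 V) :=
  {e | ∃ u v : V, G.Adj u v ∧ u ∈ H.verts ∧ v ∉ H.verts ∧ e = s(u, v)}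

/-- The weight `w(H) = e(H) + e[H, G \ H] / 2` of a subgraph `H` of a (finite) graph `G`. -/
noncomputable def Subgraph.weight {V : Type*} {G : SimpleGraph V} (H : G.Subgraph) : ℚ :=
  (H.edgeSet.ncard : ℚ) + 1 / 2 * (H.leavingEdges.ncard : ℚ)

end SimpleGraph

/-! Since degrees sum to twice the number of edges, the bound says that the average degree is at
most 31/7: the excesses 7 deg(v) − 31 must have nonpositive sum. Only vertices of degree at least
five have positive excess, and each is grouped with vertices that compensate for it.

Freeness gives the main restriction. If y has degree at least five and x is a neighbor of y, then
deg(y) plus the number of neighbors of x outside N[y] is at most 6 (`card_out_add_degree_le`). So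
degrees are at most six, the closed neighborhood of a vertex of degree six is a whole component, and
a neighbor of a vertex of degree five has at most one neighbor outside its closed neighborhood.

Planarity enters only through the absence of K_{3,3}, possibly with one edge subdivided. It bounds
the number of edges inside N(y) (`IsPlanar.link_degree_bounds`, `IsPlanar.sum_link_degree_le`) and
limits how two nonadjacent vertices of degree five can share neighbors (`not_adj_of_common`).

The vertices are split into four disjoint sets, each of nonpositive total excess: components around
vertices of degree six; clusters around adjacent vertices of degree five; closed neighborhoods of
vertices of degree five without neighbors of degree five; and the rest, of degree at most four. The
delicate case is a cluster: N[y] alone may be too dense, and then one vertex of small degree at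
distance two is added (`exists_sum_degree_le`). -/

/-! ### Logarithms along paths and the nonplanarity of K_{3,3} -/

section LogChange

open Complex

/-- A continuous function of two real variables without zeros has a continuous logarithm. -/
theorem exists_continuous_log {f : ℝ × ℝ → ℂ} (hf : Continuous f) (h0 : ∀ x, f x ≠ 0) :
    ∃ L : ℝ × ℝ → ℂ, Continuous L ∧ ∀ x, exp (L x) = f x := by
  obtain ⟨F, ⟨-, hF⟩, -⟩ := isCoveringMapOn_exp.existsUnique_continuousMap_lifts
    (⟨f, hf⟩ : C(ℝ × ℝ, ℂ)) (a₀ := (0, 0)) (e₀ := log (f (0, 0)))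
    (by simpa using exp_log (h0 _)) (by simpa using h0)
  exact ⟨F, F.continuous, fun x => congr_fun hF x⟩

/-- Any two continuous logarithms of the same function change by the same amount. -/
theorem sub_eq_sub_of_exp_eq {l m : ℝ → ℂ} (hl : Continuous l) (hm : Continuous m)
    (h : ∀ s, exp (l s) = exp (m s)) : l 1 - l 0 = m 1 - m 0 := by
  have hu := isCoveringMapOn_exp.existsUnique_continuousMap_lifts
    (⟨fun s => exp (l s), by fun_prop⟩ : C(ℝ, ℂ)) (a₀ := 0) (e₀ := l 0) rfl (by simp)
  have h1 := hu.unique (y₁ := ⟨l, hl⟩) (y₂ := ⟨fun s => m s + (l 0 - m 0), by fun_prop⟩)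
    ⟨rfl, rfl⟩ ⟨by simp, ?_⟩
  · have h2 := DFunLike.congr_fun h1 1
    simp only [ContinuousMap.coe_mk] at h2
    rw [h2]; ring
  · funext s
    simp [exp_add, exp_sub, h]

open Classical in
/-- The change of a continuous logarithm of `p - c` along the path `p`. -/
noncomputable def logChange (p : ℝ → ℂ) (c : ℂ) : ℂ :=
  if h : ∃ l : ℝ → ℂ, Continuous l ∧ ∀ s, exp (l s) = p s - c then
    h.choose 1 - h.choose 0 else 0

theorem logChange_eq {p : ℝ → ℂ} {c : ℂ} {l : ℝ → ℂ} (hl : Continuous l)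
    (h : ∀ s, exp (l s) = p s - c) : logChange p c = l 1 - l 0 := by
  have hex : ∃ l : ℝ → ℂ, Continuous l ∧ ∀ s, exp (l s) = p s - c := ⟨l, hl, h⟩
  rw [logChange, dif_pos hex]
  exact sub_eq_sub_of_exp_eq hex.choose_spec.1 hl fun s => by rw [hex.choose_spec.2, h]

theorem exists_logChange_eq {p : ℝ → ℂ} (hp : Continuous p) {c u v : ℂ} (h : ∀ s, p s ≠ c)
    (hu : exp u = p 0 - c) (hv : exp v = p 1 - c) :
    ∃ n : ℤ, logChange p c = v - u + n * (2 * Real.pi * I) := by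
  obtain ⟨L, hL, hLe⟩ := exists_continuous_log (f := fun x => p x.1 - c) (by fun_prop)
    (fun x => sub_ne_zero.2 (h _))
  rw [logChange_eq (l := fun s => L (s, 0)) (by fun_prop) (fun s => hLe _)]
  have : exp (L (1, 0) - L (0, 0)) = exp (v - u) := by
    rw [exp_sub, exp_sub, hLe, hLe, hu, hv]
  exact exp_eq_exp_iff_exists_int.1 this

/-- A single continuous logarithm of `p s - q t` exists on the plane of parameters. Both sides are
its change from (0, 0) to (1, 1), along the two ways around the unit square. Passing to `q t - p s`
only adds the constant πi. -/
theorem logChange_add_logChange {p q : ℝ → ℂ} (hp : Continuous p) (hq : Continuous q)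
    (h : ∀ s t, p s ≠ q t) :
    logChange p (q 0) + logChange q (p 1) = logChange q (p 0) + logChange p (q 1) := by
  obtain ⟨L, hL, hLe⟩ := exists_continuous_log (f := fun x => p x.1 - q x.2) (by fun_prop)
    (fun x => sub_ne_zero.2 (h _ _))
  have h1 : ∀ t, logChange p (q t) = L (1, t) - L (0, t) := fun t =>
    logChange_eq (l := fun s => L (s, t)) (by fun_prop) (fun s => hLe _)
  have h2 : ∀ s, logChange q (p s) = L (s, 1) - L (s, 0) := fun s => by
    rw [logChange_eq (l := fun t => L (s, t) + Real.pi * I) (by fun_prop)]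
    · ring
    · intro t; rw [exp_add, hLe, exp_pi_mul_I]; ring
  rw [h1, h1, h2, h2]; ring

/-- Opposite differences have logarithms that differ by an odd multiple of πi. Fixing that multiple
by the order of the indices keeps track of the parity on which the K_{3,3} argument rests. -/
theorem exists_log_sub {a : Fin 3 → ℂ} (h : ∀ i k, i ≠ k → a i ≠ a k) :
    ∃ α : Fin 3 → Fin 3 → ℂ, (∀ i k, i ≠ k → exp (α i k) = a i - a k) ∧
      ∀ i k, i < k → α k i = α i k + Real.pi * I := by
  refine ⟨fun i k => if i < k then log (a i - a k) else log (a k - a i) + Real.pi * I, ?_, ?_⟩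
  · intro i k hik
    rcases lt_or_gt_of_ne hik with hlt | hlt
    · simp only [hlt, if_true]
      exact exp_log (sub_ne_zero.2 (h _ _ hik))
    · simp only [not_lt_of_gt hlt, if_false]
      rw [exp_add, exp_log (sub_ne_zero.2 (h _ _ hik.symm)), exp_pi_mul_I]; ring
  · intro i k hik
    simp only [hik, not_lt_of_gt hik, if_true, if_false]

/-- The complete bipartite graph `K_{3,3}` cannot be drawn in the plane so that independent edges
are disjoint. -/
theorem not_exists_drawing_K33_complex {a b : Fin 3 → ℂ} {p : Fin 3 → Fin 3 → ℝ → ℂ}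
    (hp : ∀ i j, Continuous (p i j)) (h0 : ∀ i j, p i j 0 = a i) (h1 : ∀ i j, p i j 1 = b j)
    (hd : ∀ i j k l, i ≠ k → j ≠ l → ∀ s t, p i j s ≠ p k l t) : False := by
  have other : ∀ i : Fin 3, ∃ j, j ≠ i := by decide
  have ha : ∀ i k, i ≠ k → a i ≠ a k := fun i k hik => by
    have := hd i 0 k 1 hik (by decide) 0 0
    rwa [h0, h0] at this
  have hb : ∀ j l, j ≠ l → b j ≠ b l := fun j l hjl => by
    have := hd 0 j 1 l (by decide) hjl 1 1
    rwa [h1, h1] at this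
  have hab : ∀ i j, a i ≠ b j := fun i j => by
    obtain ⟨k, hk⟩ := other i
    obtain ⟨l, hl⟩ := other j
    have := hd i l k j hk.symm hl 0 1
    rwa [h0, h1] at this
  have hpa : ∀ i j k, i ≠ k → ∀ s, p i j s ≠ a k := fun i j k hik s => by
    obtain ⟨l, hl⟩ := other j
    have := hd i j k l hik hl.symm s 0
    rwa [h0] at this
  have hpb : ∀ i j l, j ≠ l → ∀ s, p i j s ≠ b l := fun i j l hjl s => by
    obtain ⟨k, hk⟩ := other i
    have := hd i j k l hk.symm hjl s 1
    rwa [h1] at this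
  obtain ⟨α, hα, hα'⟩ := exists_log_sub ha
  obtain ⟨β, hβ, hβ'⟩ := exists_log_sub hb
  have hγ : ∀ i j, exp (log (a i - b j)) = a i - b j := fun i j =>
    exp_log (sub_ne_zero.2 (hab i j))
  generalize hγd : (fun i j => log (a i - b j)) = γ
  replace hγ : ∀ i j, exp (γ i j) = a i - b j := fun i j => by rw [← hγd]; exact hγ i j
  have hγ2 : ∀ i j, exp (γ i j + Real.pi * I) = b j - a i := fun i j => by
    rw [exp_add, hγ, exp_pi_mul_I]; ring
  -- Relative to the fixed logarithms α, β, γ, every change of logarithm is recorded by an integer.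
  -- The value 0 for equal indices is a dummy.
  have hn : ∀ i j k, ∃ n : ℤ, i ≠ k →
      logChange (p i j) (a k) = γ k j + Real.pi * I - α i k + n * (2 * Real.pi * I) := by
    intro i j k
    by_cases hik : i = k
    · exact ⟨0, fun h => absurd hik h⟩
    · obtain ⟨n, hn⟩ := exists_logChange_eq (hp i j) (hpa i j k hik)
        (u := α i k) (v := γ k j + Real.pi * I) (by rw [h0, hα _ _ hik]) (by rw [h1, hγ2])
      exact ⟨n, fun _ => hn⟩
  have hm : ∀ i j l, ∃ n : ℤ, j ≠ l →
      logChange (p i j) (b l) = β j l - γ i l + n * (2 * Real.pi * I) := by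
    intro i j l
    by_cases hjl : j = l
    · exact ⟨0, fun h => absurd hjl h⟩
    · obtain ⟨n, hn⟩ := exists_logChange_eq (hp i j) (hpb i j l hjl)
        (u := γ i l) (v := β j l) (by rw [h0, hγ]) (by rw [h1, hβ _ _ hjl])
      exact ⟨n, fun _ => hn⟩
  choose n hn using hn
  choose m hm using hm
  have hpi : (2 * Real.pi * I : ℂ) ≠ 0 := two_pi_I_ne_zero
  have hsq : ∀ i j k l, i < k → j ≠ l → logChange (p i j) (a k) + logChange (p k l) (b j) =
      logChange (p k l) (a i) + logChange (p i j) (b l) := fun i j k l hik hjl => by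
    have := logChange_add_logChange (hp i j) (hp k l) (hd i j k l hik.ne hjl)
    rwa [h0, h0, h1, h1] at this
  -- The constant is 1 when the pairs of indices are ordered alike, since the two jumps by πi then
  -- add up; in `key2` they cancel.
  have key1 : ∀ i j k l, i < k → j < l →
      1 + n i j k + m k l j - n k l i - m i j l = 0 := by
    intro i j k l hik hjl
    have h := hsq i j k l hik hjl.ne
    rw [hn _ _ _ hik.ne, hn _ _ _ hik.ne', hm _ _ _ hjl.ne, hm _ _ _ hjl.ne', hα' _ _ hik,
      hβ' _ _ hjl] at h
    have h' : ((1 + n i j k + m k l j - n k l i - m i j l : ℤ) : ℂ) * (2 * Real.pi * I) = 0 := by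
      push_cast
      linear_combination h
    exact_mod_cast (mul_eq_zero.1 h').resolve_right hpi
  have key2 : ∀ i j k l, i < k → l < j →
      n i j k + m k l j - n k l i - m i j l = 0 := by
    intro i j k l hik hjl
    have h := hsq i j k l hik hjl.ne'
    rw [hn _ _ _ hik.ne, hn _ _ _ hik.ne', hm _ _ _ hjl.ne, hm _ _ _ hjl.ne', hα' _ _ hik,
      hβ' _ _ hjl] at h
    have h' : ((n i j k + m k l j - n k l i - m i j l : ℤ) : ℂ) * (2 * Real.pi * I) = 0 := by
      push_cast
      linear_combination h
    exact_mod_cast (mul_eq_zero.1 h').resolve_right hpi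
  -- The contradiction is one of parity: each of the integers occurs in exactly two of the eighteen
  -- relations, with coefficients ±1, while the constants add up to 9.
  have e1 := fun i k h => key1 i 0 k 1 h (by decide)
  have e2 := fun i k h => key1 i 0 k 2 h (by decide)
  have e3 := fun i k h => key1 i 1 k 2 h (by decide)
  have e4 := fun i k h => key2 i 1 k 0 h (by decide)
  have e5 := fun i k h => key2 i 2 k 0 h (by decide)
  have e6 := fun i k h => key2 i 2 k 1 h (by decide)
  have f1 := e1 0 1 (by decide)
  have f2 := e1 0 2 (by decide)
  have f3 := e1 1 2 (by decide)
  have f4 := e2 0 1 (by decide)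
  have f5 := e2 0 2 (by decide)
  have f6 := e2 1 2 (by decide)
  have f7 := e3 0 1 (by decide)
  have f8 := e3 0 2 (by decide)
  have f9 := e3 1 2 (by decide)
  have g1 := e4 0 1 (by decide)
  have g2 := e4 0 2 (by decide)
  have g3 := e4 1 2 (by decide)
  have g4 := e5 0 1 (by decide)
  have g5 := e5 0 2 (by decide)
  have g6 := e5 1 2 (by decide)
  have g7 := e6 0 1 (by decide)
  have g8 := e6 0 2 (by decide)
  have g9 := e6 1 2 (by decide)
  omega

end LogChange

theorem not_exists_drawing_K33 {a b : Fin 3 → EuclideanSpace ℝ (Fin 2)}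
    (γ : ∀ i j, _root_.Path (a i) (b j))
    (hd : ∀ i j k l, i ≠ k → j ≠ l → Disjoint (Set.range (γ i j)) (Set.range (γ k l))) :
    False := by
  let φ : EuclideanSpace ℝ (Fin 2) → ℂ := Complex.orthonormalBasisOneI.repr.symm
  have hφ : Continuous φ := Complex.orthonormalBasisOneI.repr.symm.continuous
  have hinj : Function.Injective φ := Complex.orthonormalBasisOneI.repr.symm.injective
  refine not_exists_drawing_K33_complex (a := fun i => φ (a i)) (b := fun j => φ (b j))
    (p := fun i j s => φ ((γ i j).extend s)) (fun i j => by fun_prop) (by simp) (by simp) ?_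
  intro i j k l hik hjl s t h
  have h1 : (γ i j).extend s ∈ Set.range (γ i j) := by
    rw [← (γ i j).extend_range]; exact ⟨s, rfl⟩
  have h2 : (γ i j).extend s ∈ Set.range (γ k l) := by
    rw [hinj h, ← (γ k l).extend_range]; exact ⟨t, rfl⟩
  exact Set.disjoint_left.1 (hd i j k l hik hjl) h1 h2

/-! ### Configurations excluded by planarity -/

namespace SimpleGraph

variable {V : Type*} {G : SimpleGraph V}

namespace PlaneEmbedding

/-- The arc of an edge as a path between its ends. -/
noncomputable def path (E : PlaneEmbedding G) {u v : V} (h : G.Adj u v) :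
    _root_.Path (E.point u) (E.point v) :=
  (E.isPlaneArc u v h).choose

theorem range_path (E : PlaneEmbedding G) {u v : V} (h : G.Adj u v) :
    Set.range (E.path h) = E.curve s(u, v) :=
  (E.isPlaneArc u v h).choose_spec.2

theorem disjoint_range_path (E : PlaneEmbedding G) {u v w x : V} (h : G.Adj u v) (h' : G.Adj w x)
    (huw : u ≠ w) (hux : u ≠ x) (hvw : v ≠ w) (hvx : v ≠ x) :
    Disjoint (Set.range (E.path h)) (Set.range (E.path h')) := by
  rw [range_path, range_path, Set.disjoint_iff_inter_eq_empty, ← Set.subset_empty_iff]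
  refine (E.inter_subset _ h _ h' ?_).trans ?_
  · simp [huw, hux]
  · rintro _ ⟨y, ⟨h1, h2⟩, -⟩
    simp only [Sym2.mem_iff] at h1 h2
    rcases h1 with rfl | rfl <;> rcases h2 with rfl | rfl <;> contradiction

end PlaneEmbedding

/-- A planar graph contains no `K_{3,3}`, not even one where an edge is subdivided once. -/
theorem IsPlanar.not_subdivided_K33 (hG : G.IsPlanar) {a b : Fin 3 → V}
    (ha : Function.Injective a) (hb : Function.Injective b) (hab : ∀ i j, a i ≠ b j)
    (h : ∀ i j, ¬(i = 2 ∧ j = 2) → G.Adj (a i) (b j)) {w : V} (haw : G.Adj (a 2) w)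
    (hwb : G.Adj w (b 2)) (hwa' : ∀ i, a i ≠ w) (hwb' : ∀ j, b j ≠ w) : False := by
  obtain ⟨E⟩ := hG
  let γ : ∀ i j, _root_.Path (E.point (a i)) (E.point (b j)) := fun i j =>
    if hij : i = 2 ∧ j = 2 then
      ((E.path haw).trans (E.path hwb)).cast (by rw [hij.1]) (by rw [hij.2])
    else E.path (h i j hij)
  have hγ1 : ∀ i j (hij : ¬(i = 2 ∧ j = 2)), Set.range (γ i j) = Set.range (E.path (h i j hij)) :=
    fun i j hij => by simp only [γ, dif_neg hij]
  have hγ2 : Set.range (γ 2 2) = Set.range (E.path haw) ∪ Set.range (E.path hwb) := by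
    simp only [γ, dif_pos, true_and, _root_.Path.cast_coe, _root_.Path.trans_range]
  have h22 : ∀ k l, (2 : Fin 3) ≠ k → (2 : Fin 3) ≠ l →
      Disjoint (Set.range (γ 2 2)) (Set.range (γ k l)) := by
    intro k l hk hl
    rw [hγ2, hγ1 k l (fun h => hk h.1.symm), Set.disjoint_union_left]
    exact ⟨E.disjoint_range_path _ _ (ha.ne hk) (hab _ _) (hwa' _).symm (hwb' _).symm,
      E.disjoint_range_path _ _ (hwa' _).symm (hwb' _).symm (hab _ _).symm (hb.ne hl)⟩
  refine not_exists_drawing_K33 γ fun i j k l hik hjl => ?_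
  by_cases hij : i = 2 ∧ j = 2
  · obtain ⟨rfl, rfl⟩ := hij
    exact h22 k l hik hjl
  by_cases hkl : k = 2 ∧ l = 2
  · obtain ⟨rfl, rfl⟩ := hkl
    exact (h22 i j hik.symm hjl.symm).symm
  rw [hγ1 i j hij, hγ1 k l hkl]
  exact E.disjoint_range_path _ _ (ha.ne hik) (hab _ _) (hab _ _).symm (hb.ne hjl)

/-- A planar graph contains no `K_{3,3}`. -/
theorem IsPlanar.not_K33 (hG : G.IsPlanar) {a b : Fin 3 → V} (ha : Function.Injective a)
    (hb : Function.Injective b) (h : ∀ i j, G.Adj (a i) (b j)) : False := by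
  obtain ⟨E⟩ := hG
  refine not_exists_drawing_K33 (fun i j => E.path (h i j)) fun i j k l hik hjl => ?_
  exact E.disjoint_range_path _ _ (ha.ne hik) (h _ _).ne (h _ _).ne' (hb.ne hjl)

/-- Three distinct vertices of a planar graph have at most two common neighbors. -/
theorem IsPlanar.card_common_le [Fintype V] [DecidableEq V] [DecidableRel G.Adj]
    (hG : G.IsPlanar) {x y z : V} (hxy : x ≠ y) (hxz : x ≠ z) (hyz : y ≠ z) {S : Finset V}
    (hx : S ⊆ G.neighborFinset x) (hy : S ⊆ G.neighborFinset y) (hz : S ⊆ G.neighborFinset z) :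
    S.card ≤ 2 := by
  by_contra! hS
  obtain ⟨u, hu, v, hv, w, hw, huv, huw, hvw⟩ := Finset.two_lt_card.1 hS
  have key : ∀ s ∈ S, G.Adj x s ∧ G.Adj y s ∧ G.Adj z s := fun s hs =>
    ⟨by simpa using hx hs, by simpa using hy hs, by simpa using hz hs⟩
  refine hG.not_K33 (a := ![x, y, z]) (b := ![u, v, w]) ?_ ?_ ?_
  · intro i j; fin_cases i <;> fin_cases j <;> simp [*, hxy.symm, hxz.symm, hyz.symm]
  · intro i j; fin_cases i <;> fin_cases j <;> simp [*, huv.symm, huw.symm, hvw.symm]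
  · intro i j; fin_cases i <;> fin_cases j <;> simp [key _ hu, key _ hv, key _ hw]

/-- A planar graph contains no wheel over a `5`-cycle with a doubled hub. -/
theorem IsPlanar.not_double_wheel (hG : G.IsPlanar) {y h v₁ v₂ v₃ v₄ v₅ : V} (hyh : G.Adj y h)
    (hy : ∀ v ∈ [v₁, v₂, v₃, v₄, v₅], G.Adj y v) (hh : ∀ v ∈ [v₁, v₂, v₃, v₄, v₅], G.Adj h v)
    (hn : [v₁, v₂, v₃, v₄, v₅].Nodup) (h₁₂ : G.Adj v₁ v₂) (h₂₃ : G.Adj v₂ v₃) (h₃₄ : G.Adj v₃ v₄)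
    (h₄₅ : G.Adj v₄ v₅) (h₅₁ : G.Adj v₅ v₁) : False := by
  simp only [List.mem_cons, List.not_mem_nil, or_false, forall_eq_or_imp, forall_eq] at hy hh
  simp only [List.nodup_cons, List.mem_cons, List.not_mem_nil, or_false, not_or, not_false_eq_true,
    List.nodup_nil, and_true] at hn
  obtain ⟨y₁, y₂, y₃, y₄, y₅⟩ := hy
  obtain ⟨g₁, g₂, g₃, g₄, g₅⟩ := hh
  obtain ⟨⟨n₁₂, n₁₃, n₁₄, n₁₅⟩, ⟨n₂₃, n₂₄, n₂₅⟩, ⟨n₃₄, n₃₅⟩, n₄₅⟩ := hn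
  -- Of the nine edges needed, only `v₁v₄` may be missing; the path through `v₅` replaces it.
  refine hG.not_subdivided_K33 (a := ![y, v₃, v₁]) (b := ![h, v₂, v₄]) (w := v₅) ?_ ?_ ?_ ?_
    h₅₁.symm h₄₅.symm ?_ ?_
  · intro i j; fin_cases i <;> fin_cases j <;> simp [y₁.ne, y₃.ne, y₁.ne', y₃.ne', n₁₃, Ne.symm n₁₃]
  · intro i j; fin_cases i <;> fin_cases j <;> simp [g₂.ne, g₄.ne, g₂.ne', g₄.ne', n₂₄, Ne.symm n₂₄]
  · intro i j
    fin_cases i <;> fin_cases j <;> simp [hyh.ne, y₂.ne, y₄.ne, g₃.ne', g₁.ne', Ne.symm n₂₃, n₁₂,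
      n₃₄, n₁₄]
  · intro i j
    fin_cases i <;> fin_cases j <;> simp [hyh, y₂, y₄, g₃.symm, g₁.symm, h₁₂, h₂₃.symm, h₃₄]
  · intro i; fin_cases i <;> simp [y₅.ne, n₃₅, n₁₅]
  · intro i; fin_cases i <;> simp [g₅.ne, n₂₅, n₄₅]

end SimpleGraph

/-! ### Neighborhoods in graphs without the double star -/

namespace SimpleGraph

variable {V : Type*} {G : SimpleGraph V}

theorem doubleStar_isContained {k l : ℕ} {x y : V} (hxy : G.Adj x y) {A B : Finset V}
    (hA : A.card = k) (hB : B.card = l) (hxA : ∀ a ∈ A, G.Adj x a) (hyB : ∀ b ∈ B, G.Adj y b)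
    (hyA : y ∉ A) (hxB : x ∉ B) (hAB : Disjoint A B) : (doubleStar k l).IsContained G := by
  obtain ⟨f, hf, hfA⟩ : ∃ f : Fin k → V, Function.Injective f ∧ ∀ i, f i ∈ A :=
    ⟨fun i => (A.equivFinOfCardEq hA).symm i,
      Subtype.val_injective.comp (A.equivFinOfCardEq hA).symm.injective, fun i => Subtype.prop _⟩
  obtain ⟨g, hg, hgB⟩ : ∃ g : Fin l → V, Function.Injective g ∧ ∀ i, g i ∈ B :=
    ⟨fun i => (B.equivFinOfCardEq hB).symm i,
      Subtype.val_injective.comp (B.equivFinOfCardEq hB).symm.injective, fun i => Subtype.prop _⟩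
  have hxf : ∀ i, G.Adj x (f i) := fun i => hxA _ (hfA i)
  have hyg : ∀ i, G.Adj y (g i) := fun i => hyB _ (hgB i)
  have hyf : ∀ i, f i ≠ y := fun i h => hyA (h ▸ hfA i)
  have hxg : ∀ i, g i ≠ x := fun i h => hxB (h ▸ hgB i)
  have hfg : ∀ i j, f i ≠ g j := fun i j => Finset.disjoint_iff_ne.1 hAB _ (hfA i) _ (hgB j)
  let φ : Option (Fin k) ⊕ Option (Fin l) → V
    | .inl none => x
    | .inl (some i) => f i
    | .inr none => y
    | .inr (some i) => g i
  refine ⟨⟨⟨φ, ?_⟩, ?_⟩⟩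
  · rintro ((_ | i) | (_ | i)) ((_ | j) | (_ | j)) h <;>
      simp [doubleStar, edge_adj, SimpleGraph.sum] at h
    exacts [hxf _, hxy, (hxf _).symm, hxy.symm, hyg _, (hyg _).symm]
  · rintro ((_ | i) | (_ | i)) ((_ | j) | (_ | j)) h
    · rfl
    · exact absurd h (hxf _).ne
    · exact absurd h hxy.ne
    · exact absurd h (hxg _).symm
    · exact absurd h (hxf _).ne'
    · rw [hf h]
    · exact absurd h (hyf _)
    · exact absurd h (hfg _ _)
    · exact absurd h hxy.ne'
    · exact absurd h (hyf _).symm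
    · rfl
    · exact absurd h (hyg _).ne
    · exact absurd h (hxg _)
    · exact absurd h (hfg _ _).symm
    · exact absurd h (hyg _).ne'
    · rw [hg h]

variable [Fintype V] [DecidableEq V] [DecidableRel G.Adj]

/-- A Hall-type argument: the leaves available at x number at least 2, those at y at least 4, so six
in the union would suffice to choose disjoint sets of 2 and 4 leaves. -/
theorem card_union_neighborFinset_le (hf : (doubleStar 2 4).Free G) {x y : V} (hxy : G.Adj x y)
    (hx : 3 ≤ G.degree x) (hy : 5 ≤ G.degree y) :
    ((G.neighborFinset x ∪ G.neighborFinset y) \ {x, y}).card ≤ 5 := by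
  by_contra! hc
  set P := G.neighborFinset x \ {y} with hP
  set R := G.neighborFinset y \ {x} with hR
  have hPc : 2 ≤ P.card := by
    have := Finset.le_card_sdiff {y} (G.neighborFinset x)
    rw [card_neighborFinset_eq_degree, Finset.card_singleton, ← hP] at this
    omega
  have hRc : 4 ≤ R.card := by
    have := Finset.le_card_sdiff {x} (G.neighborFinset y)
    rw [card_neighborFinset_eq_degree, Finset.card_singleton, ← hR] at this
    omega
  have hU : 6 ≤ (P ∪ R).card := by
    refine le_trans hc (Finset.card_le_card fun v hv => ?_)
    simp only [Finset.mem_sdiff, Finset.mem_union, Finset.mem_insert, Finset.mem_singleton,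
      not_or] at hv
    simp only [hP, hR, Finset.mem_union, Finset.mem_sdiff, Finset.mem_singleton]
    tauto
  -- The leaves of x are taken from outside `R` as far as possible. Either all of `P \ R` is used,
  -- and `R \ A` is what remains of the union, or `R` is left untouched.
  obtain ⟨A, hAP, hA, hRA⟩ : ∃ A ⊆ P, A.card = 2 ∧ 4 ≤ (R \ A).card := by
    rcases le_total (P \ R).card 2 with h | h
    · obtain ⟨A, h1, h2, h3⟩ := Finset.exists_subsuperset_card_eq (Finset.sdiff_subset (s := P)) h hPc
      refine ⟨A, h2, h3, ?_⟩
      have h4 := Finset.le_card_sdiff A (P ∪ R)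
      have h5 : ((P ∪ R) \ A).card ≤ (R \ A).card := Finset.card_le_card fun v hv => by
        have := @h1 v
        simp only [Finset.mem_sdiff, Finset.mem_union] at hv this ⊢
        tauto
      omega
    · obtain ⟨A, h1, h2⟩ := Finset.exists_subset_card_eq h
      refine ⟨A, h1.trans Finset.sdiff_subset, h2, ?_⟩
      rwa [Finset.sdiff_eq_self_of_disjoint]
      exact Finset.disjoint_of_subset_right h1 Finset.disjoint_sdiff
  obtain ⟨B, hBR, hB⟩ := Finset.exists_subset_card_eq hRA
  refine hf (doubleStar_isContained hxy hA hB (fun a ha => ?_) (fun b hb => ?_) (fun h => ?_)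
    (fun h => ?_) ?_)
  · have := hAP ha
    simp only [hP, Finset.mem_sdiff, mem_neighborFinset] at this
    exact this.1
  · have := hBR hb
    simp only [hR, Finset.mem_sdiff, mem_neighborFinset] at this
    exact this.1.1
  · simpa [hP] using hAP h
  · simpa [hR] using hBR h
  · exact Finset.disjoint_of_subset_right hBR Finset.disjoint_sdiff

section Free

variable (hf : (doubleStar 2 4).Free G) (hd : ∀ v, 3 ≤ G.degree v)
include hf hd

theorem degree_le_six (y : V) : G.degree y ≤ 6 := by
  by_contra! h
  obtain ⟨x, hx⟩ := (G.degree_pos_iff_exists_adj y).1 (by omega)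
  have h1 := card_union_neighborFinset_le hf hx.symm (hd x) (by omega)
  have h2 : (G.neighborFinset y \ {x}).card ≤
      ((G.neighborFinset x ∪ G.neighborFinset y) \ {x, y}).card :=
    Finset.card_le_card fun v hv => by
      simp only [Finset.mem_sdiff, mem_neighborFinset, Finset.mem_singleton] at hv
      simp [hv.1, hv.2, hv.1.ne']
  have h3 := Finset.le_card_sdiff {x} (G.neighborFinset y)
  rw [card_neighborFinset_eq_degree, Finset.card_singleton] at h3
  omega

/-- The neighbors of x outside N[y] and the neighbors of y other than x are disjoint sets of
possible leaves, so together they number at most five. -/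
theorem card_out_add_degree_le {x y : V} (hxy : G.Adj y x) (hy : 5 ≤ G.degree y) :
    (G.neighborFinset x \ insert y (G.neighborFinset y)).card + G.degree y ≤ 6 := by
  have h1 := card_union_neighborFinset_le hf hxy.symm (hd x) hy
  have h2 : (G.neighborFinset x \ insert y (G.neighborFinset y)) ∪ (G.neighborFinset y \ {x}) ⊆
      (G.neighborFinset x ∪ G.neighborFinset y) \ {x, y} := fun v hv => by
    simp only [Finset.mem_union, Finset.mem_sdiff, mem_neighborFinset, Finset.mem_insert, not_or,
      Finset.mem_singleton] at hv ⊢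
    rcases hv with ⟨h, h', -⟩ | ⟨h, h'⟩
    · exact ⟨.inl h, h.ne', h'⟩
    · exact ⟨.inr h, h', h.ne'⟩
  have h3 := Finset.card_le_card h2
  rw [Finset.card_union_of_disjoint] at h3
  · have h4 := Finset.le_card_sdiff {x} (G.neighborFinset y)
    rw [card_neighborFinset_eq_degree, Finset.card_singleton] at h4
    omega
  · rw [Finset.disjoint_left]
    intro v hv hv'
    simp only [Finset.mem_sdiff, mem_neighborFinset, Finset.mem_insert, not_or] at hv hv'
    exact hv.2.2 hv'.1

theorem card_out_le_one {x y : V} (hxy : G.Adj y x) (hy : G.degree y = 5) :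
    (G.neighborFinset x \ insert y (G.neighborFinset y)).card ≤ 1 := by
  have := card_out_add_degree_le hf hd hxy hy.ge
  omega

/-- Degree six leaves no room for neighbors outside, so the closed neighborhood of y is a connected
component. -/
theorem neighborFinset_subset_of_degree_six {x y : V} (hxy : G.Adj y x) (hy : G.degree y = 6) :
    G.neighborFinset x ⊆ insert y (G.neighborFinset y) := by
  have := card_out_add_degree_le hf hd hxy (by omega)
  rw [← Finset.sdiff_eq_empty_iff_subset, ← Finset.card_eq_zero]
  omega

end Free

/-- The degree of a neighbor `x` of `y`, split according to the position of the neighbors. -/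
theorem degree_eq_of_adj {x y : V} (hxy : G.Adj y x) :
    G.degree x = 1 + (G.neighborFinset x ∩ G.neighborFinset y).card +
      (G.neighborFinset x \ insert y (G.neighborFinset y)).card := by
  have h1 := Finset.card_inter_add_card_sdiff (G.neighborFinset x) (insert y (G.neighborFinset y))
  rw [Finset.inter_insert_of_mem (by simpa using hxy.symm), Finset.card_insert_of_notMem (by simp),
    card_neighborFinset_eq_degree] at h1
  omega

/-- The number of pairs of adjacent vertices of a set is even. -/
theorem even_sum_card_neighborFinset_inter (S : Finset V) :
    Even (∑ x ∈ S, (G.neighborFinset x ∩ S).card) := by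
  induction S using Finset.induction_on with
  | empty => simp
  | insert a S ha ih =>
    have h1 : ∀ x ∈ S, (G.neighborFinset x ∩ insert a S).card =
        (G.neighborFinset x ∩ S).card + if G.Adj a x then 1 else 0 := by
      intro x _
      split_ifs with h
      · rw [Finset.inter_insert_of_mem (by simpa using h.symm), Finset.card_insert_of_notMem (by simp [ha])]
      · rw [Finset.inter_insert_of_notMem (by simpa [G.adj_comm] using h), add_zero]
    have h2 : (G.neighborFinset a ∩ insert a S).card = ∑ x ∈ S, if G.Adj a x then 1 else 0 := by
      rw [Finset.inter_insert_of_notMem (by simp), ← Finset.card_filter]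
      congr 1
      ext v; simp [and_comm]
    rw [Finset.sum_insert ha, Finset.sum_congr rfl h1, Finset.sum_add_distrib, h2]
    obtain ⟨k, hk⟩ := ih
    exact ⟨k + ∑ x ∈ S, if G.Adj a x then 1 else 0, by rw [hk]; ring⟩

end SimpleGraph

/-! ### Edges inside the neighborhood of a vertex of degree five or six -/

namespace SimpleGraph

variable {V : Type*} {G : SimpleGraph V}

variable [Fintype V] [DecidableEq V] [DecidableRel G.Adj]

/-- In a graph on five vertices in which every vertex has exactly two neighbors, the vertices form
a cycle. -/
theorem exists_cycle_of_card_eq_five {T : Finset V} (hT : T.card = 5)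
    (h2 : ∀ v ∈ T, (G.neighborFinset v ∩ T).card = 2) :
    ∃ v₁ v₂ v₃ v₄ v₅, [v₁, v₂, v₃, v₄, v₅].Nodup ∧ (∀ v ∈ [v₁, v₂, v₃, v₄, v₅], v ∈ T) ∧
      G.Adj v₁ v₂ ∧ G.Adj v₂ v₃ ∧ G.Adj v₃ v₄ ∧ G.Adj v₄ v₅ ∧ G.Adj v₅ v₁ := by
  have pair : ∀ v ∈ T, ∃ a b, a ≠ b ∧ ∀ w, G.Adj v w ∧ w ∈ T ↔ w = a ∨ w = b := by
    intro v hv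
    obtain ⟨a, b, hab, h⟩ := Finset.card_eq_two.1 (h2 v hv)
    refine ⟨a, b, hab, fun w => ?_⟩
    have := Finset.ext_iff.1 h w
    simpa using this
  obtain ⟨p, hp⟩ : T.Nonempty := Finset.card_pos.1 (by omega)
  obtain ⟨q, r, hqr, hpN⟩ := pair p hp
  have hq := (hpN q).2 (.inl rfl)
  have hr := (hpN r).2 (.inr rfl)
  have hrest : (((T.erase p).erase q).erase r).card = 2 := by
    rw [Finset.card_erase_of_mem, Finset.card_erase_of_mem, Finset.card_erase_of_mem hp, hT]
    · simp [hq.1.ne', hq.2]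
    · simp [hr.1.ne', hr.2, hqr.symm]
  obtain ⟨s, t, hst, hrest⟩ := Finset.card_eq_two.1 hrest
  have hmem : ∀ v, v ∈ T ↔ v = p ∨ v = q ∨ v = r ∨ v = s ∨ v = t := by
    intro v
    have := Finset.ext_iff.1 hrest v
    simp only [Finset.mem_erase, Finset.mem_insert, Finset.mem_singleton] at this
    constructor
    · intro hv; tauto
    · rintro (rfl | rfl | rfl | h)
      exacts [hp, hq.2, hr.2, (this.2 h).2.2.2]
  have hs := Finset.ext_iff.1 hrest s
  have ht := Finset.ext_iff.1 hrest t
  simp only [Finset.mem_erase, Finset.mem_insert, Finset.mem_singleton, true_or, or_true,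
    iff_true] at hs ht
  obtain ⟨hsr, hsq, hsp, hsT⟩ := hs
  obtain ⟨htr, htq, htp, htT⟩ := ht
  have hps : ¬G.Adj p s := fun h => by
    have := (hpN s).1 ⟨h, hsT⟩
    tauto
  have hpt : ¬G.Adj p t := fun h => by
    have := (hpN t).1 ⟨h, htT⟩
    tauto
  obtain ⟨s₁, s₂, hs₁₂, hsN⟩ := pair s hsT
  obtain ⟨t₁, t₂, ht₁₂, htN⟩ := pair t htT
  obtain ⟨q₁, q₂, hq₁₂, hqN⟩ := pair q hq.2
  obtain ⟨r₁, r₂, hr₁₂, hrN⟩ := pair r hr.2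
  have hs₁ : s₁ = q ∨ s₁ = r ∨ s₁ = t := by
    have h := (hsN s₁).2 (.inl rfl)
    rcases (hmem s₁).1 h.2 with e | e | e | e | e
    exacts [absurd (e ▸ h.1).symm hps, .inl e, .inr (.inl e), absurd e h.1.ne', .inr (.inr e)]
  have hs₂ : s₂ = q ∨ s₂ = r ∨ s₂ = t := by
    have h := (hsN s₂).2 (.inr rfl)
    rcases (hmem s₂).1 h.2 with e | e | e | e | e
    exacts [absurd (e ▸ h.1).symm hps, .inl e, .inr (.inl e), absurd e h.1.ne', .inr (.inr e)]
  have ht₁ : t₁ = q ∨ t₁ = r ∨ t₁ = s := by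
    have h := (htN t₁).2 (.inl rfl)
    rcases (hmem t₁).1 h.2 with e | e | e | e | e
    exacts [absurd (e ▸ h.1).symm hpt, .inl e, .inr (.inl e), .inr (.inr e), absurd e h.1.ne']
  have ht₂ : t₂ = q ∨ t₂ = r ∨ t₂ = s := by
    have h := (htN t₂).2 (.inr rfl)
    rcases (hmem t₂).1 h.2 with e | e | e | e | e
    exacts [absurd (e ▸ h.1).symm hpt, .inl e, .inr (.inl e), .inr (.inr e), absurd e h.1.ne']
  -- One of the two neighbors of `q` is already `p`. Hence `s` and `t` must be adjacent, and
  -- attached to different ones of `q` and `r`.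
  have hqst : ¬(G.Adj q s ∧ G.Adj q t) := fun ⟨h1, h2⟩ => by
    have e1 := (hqN p).1 ⟨hq.1.symm, hp⟩
    have e2 := (hqN s).1 ⟨h1, hsT⟩
    have e3 := (hqN t).1 ⟨h2, htT⟩
    grind
  have hrst : ¬(G.Adj r s ∧ G.Adj r t) := fun ⟨h1, h2⟩ => by
    have e1 := (hrN p).1 ⟨hr.1.symm, hp⟩
    have e2 := (hrN s).1 ⟨h1, hsT⟩
    have e3 := (hrN t).1 ⟨h2, htT⟩
    grind
  have hsa₁ := ((hsN s₁).2 (.inl rfl)).1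
  have hsa₂ := ((hsN s₂).2 (.inr rfl)).1
  have hta₁ := ((htN t₁).2 (.inl rfl)).1
  have hta₂ := ((htN t₂).2 (.inr rfl)).1
  have aux : ∀ (P : V → Prop) (x y z a b : V), a ≠ b → (a = x ∨ a = y ∨ a = z) →
      (b = x ∨ b = y ∨ b = z) → P a → P b → (P x ∧ P y) ∨ (P x ∧ P z) ∨ (P y ∧ P z) := by
    clear * -
    rintro P x y z a b hab (rfl | rfl | rfl) (rfl | rfl | rfl) h1 h2 <;>
      first | exact absurd rfl hab | simp [h1, h2]
  have key : (G.Adj q s ∧ G.Adj s t ∧ G.Adj t r) ∨ (G.Adj q t ∧ G.Adj t s ∧ G.Adj s r) := by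
    have b1 := aux (G.Adj s) q r t s₁ s₂ hs₁₂ hs₁ hs₂ hsa₁ hsa₂
    have b2 := aux (G.Adj t) q r s t₁ t₂ ht₁₂ ht₁ ht₂ hta₁ hta₂
    rw [G.adj_comm q s, G.adj_comm q t] at hqst
    rw [G.adj_comm r s, G.adj_comm r t] at hrst
    rw [G.adj_comm q s, G.adj_comm q t]
    rw [G.adj_comm t s] at b2 ⊢
    generalize G.Adj s q = A1 at *
    generalize G.Adj s r = A2 at *
    generalize G.Adj t q = A3 at *
    generalize G.Adj t r = A4 at *
    generalize G.Adj s t = A5 at *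
    clear * - b1 b2 hqst hrst
    tauto
  rcases key with ⟨h1, h2, h3⟩ | ⟨h1, h2, h3⟩
  · refine ⟨p, q, s, t, r, ?_, ?_, hq.1, h1, h2, h3, hr.1.symm⟩
    · simp [hq.1.ne, hr.1.ne, hqr, Ne.symm hsp, Ne.symm htp, Ne.symm hsq, Ne.symm htq, hst, hsr, htr]
    · simp [hmem]
  · refine ⟨p, q, t, s, r, ?_, ?_, hq.1, h1, h2, h3, hr.1.symm⟩
    · simp [hq.1.ne, hr.1.ne, hqr, Ne.symm hsp, Ne.symm htp, Ne.symm hsq, Ne.symm htq, Ne.symm hst,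
        hsr, htr]
    · simp [hmem]

section Planar

variable (hG : G.IsPlanar)
include hG

/-- Two neighbors of `y` have at most two common neighbors among the neighbors of `y`. -/
theorem IsPlanar.card_link_common_le {y a b : V} (ha : G.Adj y a) (hb : G.Adj y b) (hab : a ≠ b)
    {S : Finset V} (hSa : S ⊆ G.neighborFinset a) (hSb : S ⊆ G.neighborFinset b)
    (hSy : S ⊆ G.neighborFinset y) : S.card ≤ 2 :=
  hG.card_common_le ha.ne hb.ne hab hSy hSa hSb

/-- If `y` has degree five, then two neighbors of `y` cannot both be adjacent to all the remaining
neighbors of `y`. -/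
theorem IsPlanar.link_not_dominated {y a b : V} (hy : G.degree y = 5) (ha : G.Adj y a)
    (hb : G.Adj y b) (hab : a ≠ b)
    (h : ∀ v, G.Adj y v → v ≠ a → v ≠ b → G.Adj a v ∧ G.Adj b v) : False := by
  have h1 : (((G.neighborFinset y).erase a).erase b).card = 3 := by
    rw [Finset.card_erase_of_mem (by simp [hb, hab.symm]), Finset.card_erase_of_mem (by simpa),
      card_neighborFinset_eq_degree, hy]
  have h2 := hG.card_link_common_le (S := ((G.neighborFinset y).erase a).erase b) ha hb hab
    (fun v hv => ?_) (fun v hv => ?_) (fun v hv => ?_)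
  · omega
  all_goals
    simp only [Finset.mem_erase, mem_neighborFinset] at hv ⊢
    have := h v
    tauto

/-- Two vertices of the link joined to the three others form a K_{3,3} with y. Hence at most one
vertex has link degree 4, and those of link degree 3 form a clique. Counting these vertices bounds
the sum by 15, and parity lowers this to 14. -/
theorem IsPlanar.link_degree_bounds {y : V} (hy : G.degree y = 5) :
    ∑ x ∈ G.neighborFinset y, (G.neighborFinset x ∩ G.neighborFinset y).card ≤ 14 ∧
    (∑ x ∈ G.neighborFinset y, (G.neighborFinset x ∩ G.neighborFinset y).card = 14 →
      ∃ h, G.Adj y h ∧ (G.neighborFinset h ∩ G.neighborFinset y).card = 4) ∧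
    ∀ a b, G.Adj y a → G.Adj y b → (G.neighborFinset a ∩ G.neighborFinset y).card = 4 →
      (G.neighborFinset b ∩ G.neighborFinset y).card = 4 → a = b := by
  set S := G.neighborFinset y with hS
  have hSc : S.card = 5 := by rw [hS, card_neighborFinset_eq_degree, hy]
  have hmS : ∀ {v}, v ∈ S ↔ G.Adj y v := by simp [hS]
  have hsub : ∀ x, G.neighborFinset x ∩ S ⊆ S.erase x := fun x v hv => by
    simp only [Finset.mem_inter, mem_neighborFinset] at hv
    exact Finset.mem_erase.2 ⟨hv.1.ne', hv.2⟩
  have hle : ∀ x ∈ S, (G.neighborFinset x ∩ S).card ≤ 4 := fun x hx => by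
    have := Finset.card_le_card (hsub x)
    rwa [Finset.card_erase_of_mem hx, hSc] at this
  have four : ∀ x ∈ S, (G.neighborFinset x ∩ S).card = 4 → ∀ v ∈ S, v ≠ x → G.Adj x v := by
    intro x hx h v hv hvx
    have := Finset.eq_of_subset_of_card_le (hsub x)
      (by rw [Finset.card_erase_of_mem hx, hSc, h])
    have h' : v ∈ G.neighborFinset x ∩ S := by rw [this]; simp [hv, hvx]
    simpa using (Finset.mem_inter.1 h').1
  have three : ∀ x ∈ S, (G.neighborFinset x ∩ S).card = 3 → ∀ w ∈ S, w ≠ x → ¬G.Adj x w →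
      ∀ v ∈ S, v ≠ x → v ≠ w → G.Adj x v := by
    intro x hx h w hw hwx hxw v hv hvx hvw
    have hs : G.neighborFinset x ∩ S ⊆ (S.erase x).erase w := fun u hu =>
      Finset.mem_erase.2 ⟨fun h => hxw (by simpa [h] using (Finset.mem_inter.1 hu).1), hsub x hu⟩
    have := Finset.eq_of_subset_of_card_le hs
      (by rw [Finset.card_erase_of_mem (by simp [hw, hwx]), Finset.card_erase_of_mem hx, hSc, h])
    have h' : v ∈ G.neighborFinset x ∩ S := by rw [this]; simp [hv, hvx, hvw]
    simpa using (Finset.mem_inter.1 h').1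
  set T3 := S.filter fun x => (G.neighborFinset x ∩ S).card = 3 with hT3
  set T4 := S.filter fun x => (G.neighborFinset x ∩ S).card = 4 with hT4
  have hm3 : ∀ {v}, v ∈ T3 ↔ v ∈ S ∧ (G.neighborFinset v ∩ S).card = 3 := by simp [hT3]
  have hm4 : ∀ {v}, v ∈ T4 ↔ v ∈ S ∧ (G.neighborFinset v ∩ S).card = 4 := by simp [hT4]
  have uniq : ∀ a b, G.Adj y a → G.Adj y b → (G.neighborFinset a ∩ S).card = 4 →
      (G.neighborFinset b ∩ S).card = 4 → a = b := by
    intro a b ha hb ha4 hb4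
    by_contra hab
    exact hG.link_not_dominated hy ha hb hab fun v hv hva hvb =>
      ⟨four a (hmS.2 ha) ha4 v (hmS.2 hv) hva, four b (hmS.2 hb) hb4 v (hmS.2 hv) hvb⟩
  have hT4c : T4.card ≤ 1 := Finset.card_le_one.2 fun a ha b hb =>
    uniq a b (hmS.1 (hm4.1 ha).1) (hmS.1 (hm4.1 hb).1) (hm4.1 ha).2 (hm4.1 hb).2
  have clique3 : ∀ a ∈ T3, ∀ b ∈ T3, a ≠ b → G.Adj a b := by
    intro a ha b hb hab
    by_contra hn
    rw [hm3] at ha hb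
    exact hG.link_not_dominated hy (hmS.1 ha.1) (hmS.1 hb.1) hab fun v hv hva hvb =>
      ⟨three a ha.1 ha.2 b hb.1 hab.symm hn v (hmS.2 hv) hva hvb,
        three b hb.1 hb.2 a ha.1 hab (fun h => hn h.symm) v (hmS.2 hv) hvb hva⟩
  have hdisj : Disjoint T3 T4 := by
    rw [Finset.disjoint_left]
    intro v h3 h4
    rw [hm3] at h3; rw [hm4] at h4; omega
  have clique : ∀ a ∈ T3, (T3 ∪ T4).erase a ⊆ G.neighborFinset a ∩ S := by
    intro a ha v hv
    simp only [Finset.mem_erase, Finset.mem_union] at hv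
    have haS := (hm3.1 ha).1
    rw [Finset.mem_inter, mem_neighborFinset]
    rcases hv with ⟨hva, h | h⟩
    · exact ⟨clique3 a ha v h hva.symm, (hm3.1 h).1⟩
    · rw [hm4] at h
      exact ⟨(four v h.1 h.2 a haS hva.symm).symm, h.1⟩
  -- A vertex of `T3` is adjacent to all other vertices of `T3 ∪ T4`, but has only three neighbors
  -- in the link.
  have hcl : T3.Nonempty → T3.card + T4.card ≤ 4 := by
    rintro ⟨a, ha⟩
    have := Finset.card_le_card (clique a ha)
    rw [(hm3.1 ha).2, Finset.card_erase_of_mem (by simp [ha]), Finset.card_union_of_disjoint hdisj]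
      at this
    omega
  have hsum : ∑ x ∈ S, (G.neighborFinset x ∩ S).card ≤ 10 + T3.card + 2 * T4.card := by
    have : ∀ x ∈ S, (G.neighborFinset x ∩ S).card ≤
        2 + (if (G.neighborFinset x ∩ S).card = 3 then 1 else 0) +
          2 * (if (G.neighborFinset x ∩ S).card = 4 then 1 else 0) := by
      intro x hx
      have := hle x hx
      split_ifs <;> omega
    refine (Finset.sum_le_sum this).trans ?_
    rw [Finset.sum_add_distrib, Finset.sum_add_distrib, ← Finset.mul_sum, ← Finset.card_filter,
      ← Finset.card_filter, Finset.sum_const, hSc]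
    simp [hT3, hT4]
  have heven := even_sum_card_neighborFinset_inter (G := G) S
  rw [Nat.even_iff] at heven
  have hne : 13 ≤ ∑ x ∈ S, (G.neighborFinset x ∩ S).card → T3.Nonempty := fun h =>
    Finset.card_pos.1 (by omega)
  refine ⟨?_, fun h14 => ?_, uniq⟩
  · by_contra! hc
    have := hcl (hne (by omega))
    omega
  · by_contra! hno
    -- Without link degree 4, a sum of 14 needs four vertices of link degree 3. They form a K₄ that
    -- uses up their link degrees, so the fifth vertex is isolated in the link and the sum is only
    -- 12.
    have hT40 : T4.card = 0 := Finset.card_eq_zero.2 <| Finset.eq_empty_of_forall_notMem fun v hv =>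
      hno v (hmS.1 (hm4.1 hv).1) (hm4.1 hv).2
    have hc := hcl (hne (by omega))
    have hT3c : T3.card = 4 := by omega
    have hT3S : T3 ⊆ S := Finset.filter_subset _ _
    have hout : ∀ v ∈ S \ T3, (G.neighborFinset v ∩ S).card ≤ 0 := by
      intro v hv
      rw [Finset.mem_sdiff] at hv
      have : G.neighborFinset v ∩ S ⊆ (S \ T3).erase v := fun u hu => by
        have hu' := hsub v hu
        rw [Finset.mem_erase] at hu' ⊢
        refine ⟨hu'.1, Finset.mem_sdiff.2 ⟨hu'.2, fun hu3 => ?_⟩⟩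
        have h1 := clique u hu3
        have h2 := Finset.eq_of_subset_of_card_le h1 (by
          rw [(hm3.1 hu3).2, Finset.card_erase_of_mem (by simp [hu3]),
            Finset.card_union_of_disjoint hdisj]; omega)
        have h3 : v ∈ G.neighborFinset u ∩ S := by
          rw [Finset.mem_inter, mem_neighborFinset] at hu ⊢
          exact ⟨hu.1.symm, hv.1⟩
        rw [← h2, Finset.mem_erase, Finset.mem_union, Finset.card_eq_zero.1 hT40] at h3
        simp [hv.2] at h3
      have h4 := Finset.card_le_card this
      rw [Finset.card_erase_of_mem (Finset.mem_sdiff.2 hv),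
        Finset.card_sdiff_of_subset hT3S] at h4
      omega
    have h1 : ∑ x ∈ S \ T3, (G.neighborFinset x ∩ S).card ≤ 0 := by
      simpa using Finset.sum_le_card_nsmul _ _ _ hout
    have h2 : ∑ x ∈ T3, (G.neighborFinset x ∩ S).card = 12 := by
      rw [Finset.sum_congr rfl fun x hx => (hm3.1 hx).2]
      simp [hT3c]
    have h3 := Finset.sum_sdiff (f := fun x => (G.neighborFinset x ∩ S).card)
      hT3S
    omega

/-- The number 19 is what the closed neighborhood needs: its degree sum is 12 plus this sum, to be
at most 31. Suppose that the sum is at least 20. If some link vertex is adjacent to the five others,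
these induce a 5-cycle, giving a doubled wheel. Otherwise some h has link degree 4, its neighbors
induce a 4-cycle, and two opposite vertices of this cycle form a K_{3,3} with y. -/
theorem IsPlanar.sum_link_degree_le {y : V} (hy : G.degree y = 6) :
    ∑ x ∈ G.neighborFinset y, (G.neighborFinset x ∩ G.neighborFinset y).card ≤ 19 := by
  set S := G.neighborFinset y with hS
  have hSc : S.card = 6 := by rw [hS, card_neighborFinset_eq_degree, hy]
  have hmS : ∀ {v}, v ∈ S ↔ G.Adj y v := by simp [hS]
  have hsub : ∀ x, G.neighborFinset x ∩ S ⊆ S.erase x := fun x v hv => by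
    simp only [Finset.mem_inter, mem_neighborFinset] at hv
    exact Finset.mem_erase.2 ⟨hv.1.ne', hv.2⟩
  have hcom : ∀ a ∈ S, ∀ b ∈ S, a ≠ b →
      (G.neighborFinset a ∩ (G.neighborFinset b ∩ S)).card ≤ 2 := fun a ha b hb hab =>
    hG.card_link_common_le (hmS.1 ha) (hmS.1 hb) hab Finset.inter_subset_left
      (Finset.inter_subset_right.trans Finset.inter_subset_left)
      (Finset.inter_subset_right.trans Finset.inter_subset_right)
  by_contra! hc
  by_cases h5 : ∃ h ∈ S, (G.neighborFinset h ∩ S).card = 5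
  · obtain ⟨h, hhS, hh⟩ := h5
    have hN := Finset.eq_of_subset_of_card_le (hsub h)
      (by rw [Finset.card_erase_of_mem hhS, hSc, hh])
    set T := S.erase h with hT
    have hTc : T.card = 5 := by rw [hT, Finset.card_erase_of_mem hhS, hSc]
    have hhT : ∀ v ∈ T, G.Adj h v := fun v hv => by
      rw [← hN] at hv; simpa using (Finset.mem_inter.1 hv).1
    have hS' : S = insert h T := (Finset.insert_erase hhS).symm
    have hTS : ∀ v ∈ T, v ∈ S := fun v hv => Finset.mem_of_mem_erase hv
    have h2 : ∀ v ∈ T, (G.neighborFinset v ∩ T).card ≤ 2 := fun v hv => by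
      have := hcom v (hTS v hv) h hhS (Finset.ne_of_mem_erase hv)
      rwa [hN] at this
    have h3 : ∀ v ∈ T, (G.neighborFinset v ∩ S).card = (G.neighborFinset v ∩ T).card + 1 :=
      fun v hv => by
        rw [hS', Finset.inter_insert_of_mem (by simpa using (hhT v hv).symm),
          Finset.card_insert_of_notMem (by simp [hT])]
    have h4 : ∑ v ∈ S, (G.neighborFinset v ∩ S).card =
        5 + (∑ v ∈ T, (G.neighborFinset v ∩ T).card + 5) := by
      rw [← Finset.add_sum_erase _ _ hhS, hh, Finset.sum_congr rfl h3, Finset.sum_add_distrib]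
      simp [hTc]
    have h5 : ∑ v ∈ T, (G.neighborFinset v ∩ T).card = ∑ v ∈ T, 2 := by
      refine le_antisymm (Finset.sum_le_sum h2) ?_
      simp only [Finset.sum_const, hTc, smul_eq_mul]
      omega
    obtain ⟨v₁, v₂, v₃, v₄, v₅, hn, hm, h₁, h₂, h₃, h₄, h₅⟩ :=
      exists_cycle_of_card_eq_five hTc ((Finset.sum_eq_sum_iff_of_le h2).1 h5)
    exact hG.not_double_wheel (hmS.1 hhS) (fun v hv => hmS.1 (hTS v (hm v hv)))
      (fun v hv => hhT v (hm v hv)) hn h₁ h₂ h₃ h₄ h₅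
  · push Not at h5
    have hle : ∀ x ∈ S, (G.neighborFinset x ∩ S).card ≤ 4 := fun x hx => by
      have := Finset.card_le_card (hsub x)
      rw [Finset.card_erase_of_mem hx, hSc] at this
      have := h5 x hx
      omega
    obtain ⟨h, hhS, hh⟩ : ∃ h ∈ S, 3 < (G.neighborFinset h ∩ S).card := by
      by_contra! hno
      have := Finset.sum_le_card_nsmul _ _ _ hno
      rw [hSc, smul_eq_mul] at this
      omega
    have hh4 : (G.neighborFinset h ∩ S).card = 4 := le_antisymm (hle h hhS) hh
    set R := G.neighborFinset h ∩ S with hR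
    have hRc : (S.erase h \ R).card = 1 := by
      rw [Finset.card_sdiff_of_subset (hsub h), Finset.card_erase_of_mem hhS, hSc, hh4]
    obtain ⟨q, hq⟩ := Finset.card_eq_one.1 hRc
    have hq' : q ∈ S.erase h \ R := by rw [hq]; simp
    simp only [Finset.mem_sdiff, Finset.mem_erase] at hq'
    obtain ⟨⟨hqh, hqS⟩, hqR⟩ := hq'
    have hhR : h ∉ R := by simp [hR]
    have hRS : ∀ v ∈ R, v ∈ S := fun v hv => (Finset.mem_inter.1 hv).2
    have hRh : ∀ v ∈ R, G.Adj h v := fun v hv => by simpa using (Finset.mem_inter.1 hv).1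
    have hS' : S = insert h (insert q R) := by
      ext v
      have := Finset.ext_iff.1 hq v
      simp only [Finset.mem_sdiff, Finset.mem_erase, Finset.mem_singleton] at this
      simp only [Finset.mem_insert]
      have := hRS v
      grind
    have hqc : (G.neighborFinset q ∩ R).card ≤ 2 := hcom q hqS h hhS hqh
    have hqd : (G.neighborFinset q ∩ S).card = (G.neighborFinset q ∩ R).card := by
      have : ¬G.Adj q h := fun hadj => hqR (by simp [hR, hqS, hadj.symm])
      rw [hS', Finset.inter_insert_of_notMem (by simpa using this),
        Finset.inter_insert_of_notMem (by simp)]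
    have hRd : ∀ v ∈ R, (G.neighborFinset v ∩ S).card =
        (G.neighborFinset v ∩ R).card + 1 + if G.Adj q v then 1 else 0 := by
      intro v hv
      rw [hS', Finset.inter_insert_of_mem (by simpa using (hRh v hv).symm)]
      split_ifs with hqv
      · rw [Finset.inter_insert_of_mem (by simpa using hqv.symm),
          Finset.card_insert_of_notMem (by simp [hhR, hqh.symm]),
          Finset.card_insert_of_notMem (by simp [hqR])]
      · rw [Finset.inter_insert_of_notMem (by simpa [G.adj_comm] using hqv),
          Finset.card_insert_of_notMem (by simp [hhR])]
    have hR2 : ∀ v ∈ R, (G.neighborFinset v ∩ R).card ≤ 2 := fun v hv =>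
      hcom v (hRS v hv) h hhS (fun e => hhR (e ▸ hv))
    have hqs : ∑ v ∈ R, (if G.Adj q v then 1 else 0) = (G.neighborFinset q ∩ R).card := by
      rw [← Finset.card_filter]
      congr 1
      ext v; simp [and_comm]
    have hsum : ∑ v ∈ S, (G.neighborFinset v ∩ S).card = 4 + ((G.neighborFinset q ∩ R).card +
        (∑ v ∈ R, (G.neighborFinset v ∩ R).card + 4 + (G.neighborFinset q ∩ R).card)) := by
      have e : ∑ v ∈ S, (G.neighborFinset v ∩ S).card =
          ∑ v ∈ insert h (insert q R), (G.neighborFinset v ∩ S).card := by rw [← hS']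
      rw [e, Finset.sum_insert (by simp [hhR, hqh.symm]), Finset.sum_insert hqR,
        Finset.sum_congr rfl hRd, Finset.sum_add_distrib, Finset.sum_add_distrib, hqs, hqd, hh4]
      simp [hh4]
    -- In `hsum` the vertex `q` contributes at most 2 twice and `R` at most 8, so the total is at
    -- most 20 and equality holds throughout.
    have hRe : ∀ v ∈ R, (G.neighborFinset v ∩ R).card = 2 := by
      refine (Finset.sum_eq_sum_iff_of_le hR2).1 (le_antisymm (Finset.sum_le_sum hR2) ?_)
      simp only [Finset.sum_const, hh4, smul_eq_mul]
      omega
    obtain ⟨a, ha⟩ : R.Nonempty := Finset.card_pos.1 (by omega)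
    have hsubR : ∀ v, G.neighborFinset v ∩ R ⊆ R.erase v := fun x v hv => by
      simp only [Finset.mem_inter, mem_neighborFinset] at hv
      exact Finset.mem_erase.2 ⟨hv.1.ne', hv.2⟩
    obtain ⟨c, hc⟩ : (R.erase a \ (G.neighborFinset a ∩ R)).Nonempty := Finset.card_pos.1 (by
      rw [Finset.card_sdiff_of_subset (hsubR a), Finset.card_erase_of_mem ha, hh4, hRe a ha]
      omega)
    simp only [Finset.mem_sdiff, Finset.mem_erase, Finset.mem_inter, mem_neighborFinset,
      not_and] at hc
    obtain ⟨⟨hca, hcR⟩, hnac⟩ := hc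
    have hac : ¬G.Adj a c := fun h => hnac h hcR
    have hNeq : ∀ u ∈ R, ∀ w ∈ R, u ≠ w → ¬G.Adj u w →
        G.neighborFinset u ∩ R = (R.erase u).erase w := by
      intro u hu w hw huw hn
      refine Finset.eq_of_subset_of_card_le (fun v hv => Finset.mem_erase.2
        ⟨fun e => hn (by simpa [e] using (Finset.mem_inter.1 hv).1), hsubR u hv⟩) ?_
      rw [Finset.card_erase_of_mem (by simp [hw, huw.symm]), Finset.card_erase_of_mem hu, hh4,
        hRe u hu]
    have hNa := hNeq a ha c hcR hca.symm hac
    have hNc := hNeq c hcR a ha hca (fun e => hac e.symm)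
    rw [Finset.erase_right_comm, ← hNa] at hNc
    -- The nonadjacent vertices `a` and `c` of the 4-cycle share `h` and the two other vertices of
    -- the cycle.
    have h3 := hG.card_link_common_le (hmS.1 (hRS a ha)) (hmS.1 (hRS c hcR)) hca.symm
      (S := insert h (G.neighborFinset a ∩ R)) ?_ ?_ ?_
    · rw [Finset.card_insert_of_notMem (by simp [hhR]), hRe a ha] at h3
      omega
    · refine Finset.insert_subset (by simpa using (hRh a ha).symm) Finset.inter_subset_left
    · rw [← hNc]
      refine Finset.insert_subset (by simpa using (hRh c hcR).symm) Finset.inter_subset_left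
    · exact Finset.insert_subset hhS fun v hv => hRS v (Finset.mem_inter.1 hv).2

end Planar

end SimpleGraph

/-! ### Local structure around vertices of degree five -/

namespace SimpleGraph

variable {V : Type*} {G : SimpleGraph V}

variable [Fintype V] [DecidableEq V] [DecidableRel G.Adj]

section Local

variable (hG : G.IsPlanar) (hf : (doubleStar 2 4).Free G) (hd : ∀ v, 3 ≤ G.degree v)

include hf hd in
/-- The neighbors of a common neighbor of two nonadjacent vertices of degree five. -/
theorem eq_or_adj_of_common {y y' x v : V} (hy : G.degree y = 5) (hy' : G.degree y' = 5)
    (hne : y ≠ y') (hn : ¬G.Adj y y') (hx : G.Adj y x) (hx' : G.Adj y' x) (hv : G.Adj x v) :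
    v = y ∨ v = y' ∨ (G.Adj y v ∧ G.Adj y' v) := by
  have h1 := Finset.card_le_one.1 (card_out_le_one hf hd hx hy)
  have h2 := Finset.card_le_one.1 (card_out_le_one hf hd hx' hy')
  have h3 : v ≠ y → ¬G.Adj y v → v = y' := fun a b =>
    h1 v (by simp [hv, a, b]) y' (by simp [hx'.symm, hne.symm, hn])
  have h4 : v ≠ y' → ¬G.Adj y' v → v = y := fun a b =>
    h2 v (by simp [hv, a, b]) y (by simp [hx.symm, hne, G.adj_comm, hn])
  tauto

include hG hf hd

/-- All neighbors of x other than y and y' are common neighbors of x, y and y', so there are at most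
two of them. -/
theorem degree_le_four_of_common {y y' x : V} (hy : G.degree y = 5) (hy' : G.degree y' = 5)
    (hne : y ≠ y') (hn : ¬G.Adj y y') (hx : G.Adj y x) (hx' : G.Adj y' x) : G.degree x ≤ 4 := by
  have key : ∀ v ∈ ((G.neighborFinset x).erase y).erase y',
      G.Adj x v ∧ G.Adj y v ∧ G.Adj y' v := fun v hv => by
    simp only [Finset.mem_erase, mem_neighborFinset] at hv
    have := eq_or_adj_of_common hf hd hy hy' hne hn hx hx' hv.2.2
    tauto
  have h1 := hG.card_common_le (S := ((G.neighborFinset x).erase y).erase y') hx.ne' hx'.ne' hne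
    (fun v hv => by simpa using (key v hv).1) (fun v hv => by simpa using (key v hv).2.1)
    (fun v hv => by simpa using (key v hv).2.2)
  rw [Finset.card_erase_of_mem (by simp [hx'.symm, hne.symm]),
    Finset.card_erase_of_mem (by simp [hx.symm]), card_neighborFinset_eq_degree] at h1
  omega

/-- A vertex of degree five with a neighbor of degree five has no common neighbor with a
nonadjacent vertex of degree five. -/
theorem not_adj_of_common {y w y' x : V} (hy : G.degree y = 5) (hw : G.degree w = 5)
    (hyw : G.Adj y w) (hy' : G.degree y' = 5) (hne : y ≠ y') (hn : ¬G.Adj y y')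
    (hx : G.Adj y x) : ¬G.Adj y' x := by
  intro hx'
  -- Otherwise `w` itself would be a common neighbor of `y` and `y'`, of degree at most four. As `x`
  -- has degree at least three, there is a second common neighbor `x₂`; missing both, `w` has too
  -- few neighbors inside N(y).
  have key : ∀ u, G.Adj y u → G.Adj y' u → ¬G.Adj w u := by
    intro u hu hu' hwu
    rcases eq_or_adj_of_common hf hd hy hy' hne hn hu hu' hwu.symm with e | e | ⟨-, e⟩
    · exact hyw.ne e.symm
    · exact hn (e ▸ hyw)
    · have := degree_le_four_of_common hG hf hd hy hy' hne hn hyw e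
      omega
  have hdeg : ∀ u, G.Adj y u → G.Adj y' u → u ≠ w := by
    rintro u hu hu' rfl
    have := degree_le_four_of_common hG hf hd hy hy' hne hn hu hu'
    omega
  obtain ⟨x₂, hx₂⟩ : (((G.neighborFinset x).erase y).erase y').Nonempty := Finset.card_pos.1 (by
    rw [Finset.card_erase_of_mem (by simp [hx'.symm, hne.symm]),
      Finset.card_erase_of_mem (by simp [hx.symm]), card_neighborFinset_eq_degree]
    have := hd x
    omega)
  simp only [Finset.mem_erase, mem_neighborFinset] at hx₂
  obtain ⟨hx₂', hx₂y, hxx₂⟩ := hx₂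
  obtain ⟨h1, h2⟩ : G.Adj y x₂ ∧ G.Adj y' x₂ := by
    have := eq_or_adj_of_common hf hd hy hy' hne hn hx hx' hxx₂
    tauto
  have hsub : G.neighborFinset w ∩ G.neighborFinset y ⊆
      (((G.neighborFinset y).erase w).erase x).erase x₂ := fun v hv => by
    simp only [Finset.mem_inter, mem_neighborFinset] at hv
    simp only [Finset.mem_erase, mem_neighborFinset]
    refine ⟨?_, ?_, hv.1.ne', hv.2⟩
    · rintro rfl; exact key _ h1 h2 hv.1
    · rintro rfl; exact key _ hx hx' hv.1
  have h3 := Finset.card_le_card hsub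
  rw [Finset.card_erase_of_mem (by simp [h1, hdeg x₂ h1 h2, hxx₂.ne']),
    Finset.card_erase_of_mem (by simp [hx, hdeg x hx hx']),
    Finset.card_erase_of_mem (by simpa), card_neighborFinset_eq_degree] at h3
  have h4 := degree_eq_of_adj hyw
  have h5 := card_out_le_one hf hd hyw hy
  omega

theorem degree_le_four_of_adj_adj {y x z : V} (hy : G.degree y = 5) (hx : G.degree x = 5)
    (hyx : G.Adj y x) (hxz : G.Adj x z) (hzy : z ≠ y) (hn : ¬G.Adj y z) : G.degree z ≤ 4 := by
  have h1 := degree_le_six hf hd z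
  have h2 : G.degree z ≠ 6 := fun h => by
    have : y ∈ insert z (G.neighborFinset z) :=
      neighborFinset_subset_of_degree_six hf hd hxz.symm h (by simpa using hyx.symm)
    simp [hzy.symm, G.adj_comm, hn] at this
  have h3 : G.degree z ≠ 5 := fun h =>
    not_adj_of_common hG hf hd hy hx hyx h hzy.symm hn hyx hxz.symm
  omega

/-- The closed neighborhood of a vertex of degree five, together with at most one further vertex,
has small degree sum. -/
theorem exists_sum_degree_le {y : V} (hy : G.degree y = 5)
    (hle : ∀ x, G.Adj y x → G.degree x ≤ 5) :
    ∃ Z : Finset V, (∀ z ∈ Z, z ≠ y ∧ ¬G.Adj y z ∧ ∃ x, G.Adj y x ∧ G.degree x = 5 ∧ G.Adj x z) ∧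
      7 * (∑ v ∈ insert y (G.neighborFinset y), G.degree v + ∑ z ∈ Z, G.degree z) ≤
        31 * (6 + Z.card) := by
  obtain ⟨hin14, hin4, huniq⟩ := hG.link_degree_bounds hy
  have heven := even_sum_card_neighborFinset_inter (G := G) (G.neighborFinset y)
  rw [Nat.even_iff] at heven
  have hScard : (G.neighborFinset y).card = 5 := by rw [card_neighborFinset_eq_degree, hy]
  set inn : V → ℕ := fun x => (G.neighborFinset x ∩ G.neighborFinset y).card with hinn
  set out : V → ℕ := fun x => (G.neighborFinset x \ insert y (G.neighborFinset y)).card with hout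
  have hdeg : ∀ x ∈ G.neighborFinset y, G.degree x = 1 + inn x + out x := fun x hx =>
    degree_eq_of_adj (by simpa using hx)
  have hout1 : ∀ x ∈ G.neighborFinset y, out x ≤ 1 := fun x hx =>
    card_out_le_one hf hd (by simpa using hx) hy
  have hle' : ∀ x ∈ G.neighborFinset y, inn x + out x ≤ 4 := fun x hx => by
    have := hdeg x hx
    have := hle x (by simpa using hx)
    omega
  have hsum : ∑ v ∈ insert y (G.neighborFinset y), G.degree v =
      10 + ∑ x ∈ G.neighborFinset y, inn x + ∑ x ∈ G.neighborFinset y, out x := by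
    rw [Finset.sum_insert (by simp), hy, Finset.sum_congr rfl hdeg, Finset.sum_add_distrib,
      Finset.sum_add_distrib, Finset.sum_const, hScard]
    ring
  have hL5 : ∑ x ∈ G.neighborFinset y, out x ≤ 5 := by
    simpa [hScard] using Finset.sum_le_card_nsmul _ _ _ hout1
  set Sin := ∑ x ∈ G.neighborFinset y, inn x with hSin
  set L := ∑ x ∈ G.neighborFinset y, out x with hL
  by_cases h16 : Sin + L ≤ 16
  · exact ⟨∅, by simp, by simp only [Finset.sum_empty, Finset.card_empty, hsum]; omega⟩
  -- Otherwise inn + 2 out ≤ 4 at every neighbor. Summing, with Sin ≤ 14 and Sin + L ≥ 17, forces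
  -- equality everywhere and L = 3; then two neighbors have out = 0 and inn = 4, against uniqueness.
  obtain ⟨x, hxS, hx3, hx1⟩ : ∃ x ∈ G.neighborFinset y, 3 ≤ inn x ∧ 1 ≤ out x := by
    by_contra! hno
    have h4 : ∀ x ∈ G.neighborFinset y, inn x + 2 * out x ≤ 4 := fun x hx => by
      have h1 := hno x hx
      have h2 := hout1 x hx
      have h3 := hle' x hx
      omega
    have h5 : ∑ x ∈ G.neighborFinset y, (inn x + 2 * out x) = Sin + 2 * L := by
      rw [Finset.sum_add_distrib, ← Finset.mul_sum]
    have h6 : ∑ x ∈ G.neighborFinset y, (inn x + 2 * out x) ≤ ∑ x ∈ G.neighborFinset y, 4 :=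
      Finset.sum_le_sum h4
    rw [h5, Finset.sum_const, hScard, smul_eq_mul] at h6
    have h7 := (Finset.sum_eq_sum_iff_of_le h4).1 (by
      rw [h5, Finset.sum_const, hScard, smul_eq_mul]; omega)
    have h8 : 1 < ((G.neighborFinset y).filter fun x => out x = 0).card := by
      have h9 := Finset.card_filter_add_card_filter_not (s := G.neighborFinset y)
        (fun x => out x = 0)
      have h10 : ((G.neighborFinset y).filter fun x => ¬out x = 0).card ≤ L := by
        rw [Finset.card_filter]
        refine Finset.sum_le_sum fun x _ => ?_
        split_ifs <;> omega
      omega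
    obtain ⟨a, ha, b, hb, hab⟩ := Finset.one_lt_card.1 h8
    rw [Finset.mem_filter] at ha hb
    have ha7 := h7 a ha.1
    have hb7 := h7 b hb.1
    exact hab (huniq a b (by simpa using ha.1) (by simpa using hb.1)
      (show inn a = 4 by omega) (show inn b = 4 by omega))
  have hyx : G.Adj y x := by simpa using hxS
  have hx4 := hle' x hxS
  have hxd : G.degree x = 5 := by have := hdeg x hxS; omega
  obtain ⟨z, hz⟩ : (G.neighborFinset x \ insert y (G.neighborFinset y)).Nonempty :=
    Finset.card_pos.1 hx1
  have hzu := Finset.card_le_one.1 (hout1 x hxS) z hz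
  simp only [Finset.mem_sdiff, mem_neighborFinset, Finset.mem_insert, not_or] at hz hzu
  obtain ⟨hxz, hzy, hyz⟩ := hz
  refine ⟨{z}, by simpa using ⟨hzy, hyz, x, hyx, hxd, hxz⟩, ?_⟩
  rw [Finset.sum_singleton, Finset.card_singleton, hsum]
  -- With z added there are seven vertices, and Sin + L + deg(z) ≤ 21 is required. A total of 17
  -- allows deg(z) = 4; the only other possible total, 18, demands deg(z) ≤ 3.
  by_cases h17 : Sin + L ≤ 17
  · have := degree_le_four_of_adj_adj hG hf hd hy hxd hyx hxz hzy hyz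
    omega
  obtain ⟨h, hyh, hh4⟩ := hin4 (by omega)
  replace hh4 : inn h = 4 := hh4
  have hhS : h ∈ G.neighborFinset y := by simpa using hyh
  have hh0 : out h = 0 := by have := hle' h hhS; omega
  have hL4 : L ≤ 4 := by
    rw [hL, ← Finset.add_sum_erase _ _ hhS, hh0]
    have : ∑ v ∈ (G.neighborFinset y).erase h, out v ≤ _ := Finset.sum_le_card_nsmul _ _ 1
      fun v hv => hout1 v (Finset.mem_of_mem_erase hv)
    rw [Finset.card_erase_of_mem hhS, hScard, smul_eq_mul] at this
    omega
  have hzh : ¬G.Adj h z := fun hadj => by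
    have : z ∈ G.neighborFinset h \ insert y (G.neighborFinset y) := by simp [hadj, hzy, hyz]
    rw [Finset.card_eq_zero.1 hh0] at this
    simp at this
  have hhN : G.neighborFinset h ∩ G.neighborFinset y = (G.neighborFinset y).erase h := by
    refine Finset.eq_of_subset_of_card_le (fun v hv => ?_) ?_
    · simp only [Finset.mem_inter, mem_neighborFinset] at hv
      simp [hv.2, hv.1.ne']
    · rw [Finset.card_erase_of_mem hhS, hScard]
      exact hh4.ge
  -- Since h is adjacent to all other neighbors of y but not to z, the neighbors of z in N(y) are
  -- common to y, h and z. At most one more neighbor of z lies outside N[x], and none lies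
  -- elsewhere.
  have hc := hG.card_common_le (S := G.neighborFinset z ∩ G.neighborFinset y) (x := y) (y := h)
    (z := z) hyh.ne (Ne.symm hzy) (fun e => hyz (e ▸ hyh)) Finset.inter_subset_right
    (fun v hv => by
      simp only [Finset.mem_inter, mem_neighborFinset] at hv
      have : v ∈ (G.neighborFinset y).erase h := by
        simp only [Finset.mem_erase, mem_neighborFinset]
        exact ⟨fun e => hzh (e ▸ hv.1.symm), hv.2⟩
      rw [← hhN] at this
      exact (Finset.mem_inter.1 this).1) Finset.inter_subset_left
  have hzx := card_out_le_one hf hd hxz hxd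
  have hzd : G.neighborFinset z ⊆ (G.neighborFinset z ∩ G.neighborFinset y) ∪
      (G.neighborFinset z \ insert x (G.neighborFinset x)) := fun v hv => by
    have hvz : G.Adj z v := by simpa using hv
    simp only [Finset.mem_union, Finset.mem_inter, Finset.mem_sdiff, mem_neighborFinset,
      Finset.mem_insert, not_or]
    by_cases h1 : G.Adj y v
    · exact .inl ⟨hvz, h1⟩
    refine .inr ⟨hvz, fun e => h1 (e ▸ hyx), fun hxv => ?_⟩
    exact hvz.ne (hzu v ⟨hxv, fun e => hyz (e ▸ hvz.symm), h1⟩)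
  have h9 := (Finset.card_le_card hzd).trans (Finset.card_union_le _ _)
  rw [card_neighborFinset_eq_degree] at h9
  omega

end Local

end SimpleGraph

/-! ### Discharging -/

/-- By symmetry of `hd`, intersecting members are equal. Passing to the image of `f` removes
repetitions and leaves a disjoint family. -/
theorem Finset.sum_biUnion_nonpos {ι V : Type*} [DecidableEq V] {s : Finset ι}
    {f : ι → Finset V} {φ : V → ℤ} (h : ∀ i ∈ s, ∑ v ∈ f i, φ v ≤ 0)
    (hd : ∀ i ∈ s, ∀ j ∈ s, ∀ v, v ∈ f i → v ∈ f j → f i ⊆ f j) :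
    ∑ v ∈ s.biUnion f, φ v ≤ 0 := by
  have h1 : s.biUnion f = (s.image f).biUnion id := by
    rw [Finset.image_biUnion]; rfl
  rw [h1, Finset.sum_biUnion]
  · refine Finset.sum_nonpos fun t ht => ?_
    obtain ⟨i, hi, rfl⟩ := Finset.mem_image.1 ht
    exact h i hi
  · intro t ht u hu htu
    obtain ⟨i, hi, rfl⟩ := Finset.mem_image.1 (Finset.mem_coe.1 ht)
    obtain ⟨j, hj, rfl⟩ := Finset.mem_image.1 (Finset.mem_coe.1 hu)
    refine Finset.disjoint_left.2 fun v hv hv' => htu ?_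
    exact Finset.Subset.antisymm (hd i hi j hj v hv hv') (hd j hj i hi v hv' hv)

namespace SimpleGraph

variable {V : Type*} {G : SimpleGraph V}

theorem weight_top [Fintype G.edgeSet] :
    (⊤ : G.Subgraph).weight = (G.edgeFinset.card : ℚ) := by
  have h : (⊤ : G.Subgraph).leavingEdges = ∅ := by
    ext e; simp [Subgraph.leavingEdges]
  rw [Subgraph.weight, h, Subgraph.edgeSet_top, Set.ncard_eq_toFinset_card']
  simp [edgeFinset]

variable [Fintype V] [DecidableRel G.Adj]

variable (G) in
/-- The excess of the degree of a vertex over `31 / 7`, scaled by `7`. -/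
def excess (v : V) : ℤ := 7 * G.degree v - 31

theorem sum_excess (S : Finset V) :
    ∑ v ∈ S, G.excess v = 7 * ((∑ v ∈ S, G.degree v : ℕ) : ℤ) - 31 * S.card := by
  simp only [excess, Finset.sum_sub_distrib, ← Finset.mul_sum, Finset.sum_const, Nat.cast_sum,
    nsmul_eq_mul]
  ring

variable [DecidableEq V]

variable (G) in
/-- The closed neighborhood of a vertex. -/
def closedNeighborFinset (y : V) : Finset V := insert y (G.neighborFinset y)

theorem mem_closedNeighborFinset {y v : V} :
    v ∈ G.closedNeighborFinset y ↔ v = y ∨ G.Adj y v := by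
  simp [closedNeighborFinset]

theorem card_closedNeighborFinset (y : V) :
    (G.closedNeighborFinset y).card = G.degree y + 1 := by
  rw [closedNeighborFinset, Finset.card_insert_of_notMem (by simp), card_neighborFinset_eq_degree]

variable (G) in
/-- The vertices in the closed neighborhood of a vertex of degree six. -/
def sixPart : Finset V :=
  (Finset.univ.filter fun y => G.degree y = 6).biUnion G.closedNeighborFinset

variable (G) in
/-- The vertices of degree five, outside `sixPart`, with a neighbor of degree five. -/
def clusterVertices : Finset V :=
  Finset.univ.filter fun y => G.degree y = 5 ∧ y ∉ G.sixPart ∧ ∃ w, G.Adj y w ∧ G.degree w = 5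

variable (G) in
/-- The vertices of degree five, outside `sixPart`, without neighbors of degree five. -/
def isolatedFives : Finset V :=
  Finset.univ.filter fun y => G.degree y = 5 ∧ y ∉ G.sixPart ∧ ∀ w, G.Adj y w → G.degree w ≠ 5

variable (G) in
/-- The closed neighborhood of the set of vertices of degree five in the closed neighborhood
of `y`. -/
def cluster (y : V) : Finset V :=
  ((G.closedNeighborFinset y).filter fun q => G.degree q = 5).biUnion G.closedNeighborFinset

theorem mem_sixPart {v : V} :
    v ∈ G.sixPart ↔ ∃ y, G.degree y = 6 ∧ (v = y ∨ G.Adj y v) := by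
  simp [sixPart, mem_closedNeighborFinset]

theorem mem_cluster {y v : V} : v ∈ G.cluster y ↔
    ∃ q, ((q = y ∨ G.Adj y q) ∧ G.degree q = 5) ∧ (v = q ∨ G.Adj q v) := by
  simp [cluster, mem_closedNeighborFinset]

section Discharging

variable (hG : G.IsPlanar) (hf : (doubleStar 2 4).Free G) (hd : ∀ v, 3 ≤ G.degree v)

section

include hf hd

theorem mem_closedNeighborFinset_of_adj {y v w : V} (hy : G.degree y = 6)
    (hv : v ∈ G.closedNeighborFinset y) (hvw : G.Adj v w) : w ∈ G.closedNeighborFinset y := by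
  rcases mem_closedNeighborFinset.1 hv with rfl | h
  · exact mem_closedNeighborFinset.2 (.inr hvw)
  · exact neighborFinset_subset_of_degree_six hf hd h hy (by simpa using hvw)

theorem mem_sixPart_of_adj {v w : V} (hv : v ∈ G.sixPart) (hvw : G.Adj v w) : w ∈ G.sixPart := by
  obtain ⟨y, hy, h⟩ := mem_sixPart.1 hv
  have := mem_closedNeighborFinset_of_adj hf hd hy (mem_closedNeighborFinset.2 h) hvw
  exact mem_sixPart.2 ⟨y, hy, mem_closedNeighborFinset.1 this⟩

theorem degree_le_five_of_notMem_sixPart {y x : V} (hy : y ∉ G.sixPart) (hyx : G.Adj y x) :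
    G.degree x ≤ 5 := by
  have h1 := degree_le_six hf hd x
  have h2 : G.degree x ≠ 6 := fun h => hy (mem_sixPart.2 ⟨x, h, .inr hyx.symm⟩)
  omega

/-- The vertices around isolated vertices of degree five have small total excess. -/
theorem sum_excess_isolatedFives :
    ∑ v ∈ G.isolatedFives.biUnion G.closedNeighborFinset, G.excess v ≤ 0 := by
  set I := G.isolatedFives with hI
  have hmI : ∀ {y}, y ∈ I ↔ G.degree y = 5 ∧ y ∉ G.sixPart ∧ ∀ w, G.Adj y w → G.degree w ≠ 5 := by
    simp [hI, isolatedFives]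
  set X := I.biUnion (fun y => G.neighborFinset y) with hX
  have hmX : ∀ {x}, x ∈ X ↔ ∃ y ∈ I, G.Adj y x := by simp [hX]
  have hX4 : ∀ x ∈ X, G.degree x ≤ 4 := fun x hx => by
    obtain ⟨y, hy, hyx⟩ := hmX.1 hx
    obtain ⟨-, hy6, hy5⟩ := hmI.1 hy
    have h1 := degree_le_five_of_notMem_sixPart hf hd hy6 hyx
    have h2 := hy5 x hyx
    omega
  have hdisj : Disjoint I X := Finset.disjoint_left.2 fun v h1 h2 => by
    have h3 := (hmI.1 h1).1
    have h4 := hX4 v h2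
    omega
  have hU : I.biUnion G.closedNeighborFinset = I ∪ X := by
    ext v
    simp only [Finset.mem_biUnion, mem_closedNeighborFinset, Finset.mem_union, hmX]
    constructor
    · rintro ⟨y, hy, rfl | h⟩
      exacts [.inl hy, .inr ⟨y, hy, h⟩]
    · rintro (h | ⟨y, hy, h⟩)
      exacts [⟨v, h, .inl rfl⟩, ⟨y, hy, .inr h⟩]
  -- Double counting of the edges between `I` and `X`: members of `I` are pairwise nonadjacent, so
  -- besides y a vertex of `X` sees at most one, outside N[y].
  have hcount : I.card * 5 ≤ X.card * 2 := by
    refine Finset.card_mul_le_card_mul G.Adj (fun y hy => ?_) (fun x hx => ?_)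
    · rw [← (hmI.1 hy).1, ← card_neighborFinset_eq_degree]
      refine Finset.card_le_card fun v hv => ?_
      rw [mem_neighborFinset] at hv
      exact (Finset.mem_bipartiteAbove _).2 ⟨hmX.2 ⟨y, hy, hv⟩, hv⟩
    · obtain ⟨y, hy, hyx⟩ := hmX.1 hx
      obtain ⟨hy5, -, hyn⟩ := hmI.1 hy
      have h1 : (I.bipartiteBelow G.Adj x).erase y ⊆
          G.neighborFinset x \ insert y (G.neighborFinset y) := fun v hv => by
        rw [Finset.mem_erase, Finset.mem_bipartiteBelow] at hv
        simp only [Finset.mem_sdiff, mem_neighborFinset, Finset.mem_insert, not_or]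
        exact ⟨hv.2.2.symm, hv.1, fun h => hyn v h (hmI.1 hv.2.1).1⟩
      have h2 := (Finset.card_le_card h1).trans (card_out_le_one hf hd hyx hy5)
      rw [Finset.card_erase_of_mem ((Finset.mem_bipartiteBelow _).2 ⟨hy, hyx⟩)] at h2
      omega
  have h1 : ∑ v ∈ I, G.degree v ≤ I.card * 5 :=
    Finset.sum_le_card_nsmul _ _ _ fun v hv => (hmI.1 hv).1.le
  have h2 : ∑ v ∈ X, G.degree v ≤ X.card * 4 := Finset.sum_le_card_nsmul _ _ _ hX4
  rw [hU, Finset.sum_union hdisj, sum_excess, sum_excess]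
  omega

end

include hG hf hd

/-- Vertices of degree six have closed neighborhoods of small total excess. -/
theorem sum_excess_sixPart : ∑ v ∈ G.sixPart, G.excess v ≤ 0 := by
  refine Finset.sum_biUnion_nonpos (fun y hy => ?_) (fun a ha b hb v hva hvb => ?_)
  · have hy6 : G.degree y = 6 := by simpa using hy
    have h1 : ∀ x ∈ G.neighborFinset y,
        G.degree x = 1 + (G.neighborFinset x ∩ G.neighborFinset y).card := fun x hx => by
      have hyx : G.Adj y x := by simpa using hx
      rw [degree_eq_of_adj hyx, Finset.sdiff_eq_empty_iff_subset.2
        (neighborFinset_subset_of_degree_six hf hd hyx hy6), Finset.card_empty, add_zero]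
    have h2 := hG.sum_link_degree_le hy6
    have h3 : ∑ v ∈ G.closedNeighborFinset y, G.degree v =
        12 + ∑ x ∈ G.neighborFinset y, (G.neighborFinset x ∩ G.neighborFinset y).card := by
      rw [closedNeighborFinset, Finset.sum_insert (by simp), Finset.sum_congr rfl h1,
        Finset.sum_add_distrib, Finset.sum_const, card_neighborFinset_eq_degree, hy6]
      ring
    rw [sum_excess, h3, card_closedNeighborFinset, hy6]
    omega
  · have ha6 : G.degree a = 6 := by simpa using ha
    have hb6 : G.degree b = 6 := by simpa using hb
    have hab : a ∈ G.closedNeighborFinset b := by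
      rcases mem_closedNeighborFinset.1 hva with rfl | h
      · exact hvb
      · exact mem_closedNeighborFinset_of_adj hf hd hb6 hvb h.symm
    intro w hw
    rcases mem_closedNeighborFinset.1 hw with rfl | h
    · exact hab
    · exact mem_closedNeighborFinset_of_adj hf hd hb6 hab h

/-- If two vertices of degree five, one of them with a neighbor of degree five, have intersecting
closed neighborhoods, then they are equal or adjacent. -/
theorem eq_or_adj_of_mem_closedNeighborFinset {a b v : V} (ha : G.degree a = 5)
    (haw : ∃ w, G.Adj a w ∧ G.degree w = 5) (hb : G.degree b = 5)
    (hva : v = a ∨ G.Adj a v) (hvb : v = b ∨ G.Adj b v) : b = a ∨ G.Adj a b := by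
  obtain ⟨w, haw, hw⟩ := haw
  by_contra! hc
  obtain ⟨hne, hn⟩ := hc
  rcases hva with rfl | hva <;> rcases hvb with rfl | hvb
  · exact hne rfl
  · exact hn hvb.symm
  · exact hn hva
  · exact not_adj_of_common hG hf hd ha hw haw hb hne.symm hn hva hvb

/-- The set from `exists_sum_degree_le` lies inside the cluster, and every other vertex of the
cluster has degree at most four, hence negative excess. -/
theorem sum_excess_cluster {y : V} (hy : y ∈ G.clusterVertices) :
    ∑ v ∈ G.cluster y, G.excess v ≤ 0 := by
  simp only [clusterVertices, Finset.mem_filter, Finset.mem_univ, true_and] at hy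
  obtain ⟨hy5, hy6, -⟩ := hy
  obtain ⟨Z, hZ, hsum⟩ := exists_sum_degree_le hG hf hd hy5
    fun x hx => degree_le_five_of_notMem_sixPart hf hd hy6 hx
  have hdisj : Disjoint (G.closedNeighborFinset y) Z := Finset.disjoint_right.2 fun z hz h => by
    have h1 := hZ z hz
    rw [mem_closedNeighborFinset] at h
    tauto
  have hsub : G.closedNeighborFinset y ∪ Z ⊆ G.cluster y := by
    refine Finset.union_subset (fun v hv => ?_) (fun z hz => ?_)
    · exact mem_cluster.2 ⟨y, ⟨.inl rfl, hy5⟩, mem_closedNeighborFinset.1 hv⟩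
    · obtain ⟨-, -, x, hyx, hx, hxz⟩ := hZ z hz
      exact mem_cluster.2 ⟨x, ⟨.inr hyx, hx⟩, .inr hxz⟩
  have hrest : ∑ v ∈ G.cluster y \ (G.closedNeighborFinset y ∪ Z), G.excess v ≤ 0 := by
    refine Finset.sum_nonpos fun v hv => ?_
    simp only [Finset.mem_sdiff, Finset.mem_union, mem_closedNeighborFinset, not_or] at hv
    obtain ⟨hvc, ⟨hvy, hnv⟩, -⟩ := hv
    obtain ⟨q, ⟨hq, hq5⟩, hqv⟩ := mem_cluster.1 hvc
    have h4 : G.degree v ≤ 4 := by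
      rcases hq with rfl | hq
      · tauto
      · rcases hqv with rfl | hqv
        · tauto
        · exact degree_le_four_of_adj_adj hG hf hd hy5 hq5 hq hqv hvy hnv
    rw [excess]
    omega
  have hmain : ∑ v ∈ G.closedNeighborFinset y ∪ Z, G.excess v ≤ 0 := by
    rw [Finset.sum_union hdisj, sum_excess, sum_excess, card_closedNeighborFinset, hy5]
    rw [closedNeighborFinset]
    omega
  rw [← Finset.sum_sdiff hsub]
  omega

/-- Being equal or adjacent is transitive among the vertices of degree five involved, so clusters
that meet coincide. -/
theorem sum_excess_clusters : ∑ v ∈ G.clusterVertices.biUnion G.cluster, G.excess v ≤ 0 := by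
  refine Finset.sum_biUnion_nonpos (fun y hy => sum_excess_cluster hG hf hd hy) ?_
  intro a ha b hb v hva hvb
  simp only [clusterVertices, Finset.mem_filter, Finset.mem_univ, true_and] at ha hb
  obtain ⟨q, ⟨haq, hq⟩, hqv⟩ := mem_cluster.1 hva
  obtain ⟨r, ⟨hbr, hr⟩, hrv⟩ := mem_cluster.1 hvb
  have hr' : ∃ w, G.Adj r w ∧ G.degree w = 5 := by
    rcases hbr with rfl | h
    · exact hb.2.2
    · exact ⟨b, h.symm, hb.1⟩
  have symm : ∀ {u w : V}, (u = w ∨ G.Adj w u) → (w = u ∨ G.Adj u w) :=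
    fun h => h.imp Eq.symm Adj.symm
  have step := fun {c d : V} (hc : G.degree c = 5) (hd' : G.degree d = 5)
    (h1 : c = b ∨ G.Adj b c) (h2 : c = d ∨ G.Adj d c) =>
    eq_or_adj_of_mem_closedNeighborFinset hG hf hd hb.1 hb.2.2 hd' h1 h2
  have hrq : q = r ∨ G.Adj r q :=
    eq_or_adj_of_mem_closedNeighborFinset hG hf hd hr hr' hq hrv hqv
  have hbq : q = b ∨ G.Adj b q := step hr hq hbr (symm hrq)
  have hba : a = b ∨ G.Adj b a := step hq ha.1 hbq haq
  intro w hw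
  obtain ⟨p, ⟨hap, hp⟩, hpw⟩ := mem_cluster.1 hw
  exact mem_cluster.2 ⟨p, ⟨step ha.1 hp hba (symm hap), hp⟩, hpw⟩

theorem sum_excess_nonpos : ∑ v, G.excess v ≤ 0 := by
  set A := G.sixPart with hA
  set B := G.clusterVertices.biUnion G.cluster with hB
  set C := G.isolatedFives.biUnion G.closedNeighborFinset with hC
  have hmB : ∀ {v}, v ∈ B → v ∉ A ∧ ∃ q, G.degree q = 5 ∧ (∃ w, G.Adj q w ∧ G.degree w = 5) ∧
      (v = q ∨ G.Adj q v) := by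
    intro v hv
    obtain ⟨y, hy, hyv⟩ := Finset.mem_biUnion.1 hv
    simp only [clusterVertices, Finset.mem_filter, Finset.mem_univ, true_and] at hy
    obtain ⟨q, ⟨hyq, hq⟩, hqv⟩ := mem_cluster.1 hyv
    refine ⟨fun hvA => hy.2.1 ?_, q, hq, ?_, hqv⟩
    · have hqA : q ∈ A := by
        rcases hqv with rfl | h
        exacts [hvA, mem_sixPart_of_adj hf hd hvA h.symm]
      rcases hyq with rfl | h
      exacts [hqA, mem_sixPart_of_adj hf hd hqA h.symm]
    · rcases hyq with rfl | h
      exacts [hy.2.2, ⟨y, h.symm, hy.1⟩]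
  have hmC : ∀ {v}, v ∈ C → v ∉ A ∧ ∃ q, G.degree q = 5 ∧ (∀ w, G.Adj q w → G.degree w ≠ 5) ∧
      (v = q ∨ G.Adj q v) := by
    intro v hv
    obtain ⟨y, hy, hyv⟩ := Finset.mem_biUnion.1 hv
    simp only [isolatedFives, Finset.mem_filter, Finset.mem_univ, true_and] at hy
    rw [mem_closedNeighborFinset] at hyv
    refine ⟨fun hvA => hy.2.1 ?_, y, hy.1, hy.2.2, hyv⟩
    rcases hyv with rfl | h
    exacts [hvA, mem_sixPart_of_adj hf hd hvA h.symm]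
  have hAB : Disjoint A B := Finset.disjoint_right.2 fun v hv => (hmB hv).1
  -- A vertex in both `B` and `C` would make an isolated vertex of degree five equal or adjacent to
  -- one from a cluster, which gives it a neighbor of degree five.
  have hBC : Disjoint (A ∪ B) C := Finset.disjoint_right.2 fun v hv hv' => by
    obtain ⟨hvA, i, hi, hin, hiv⟩ := hmC hv
    rcases Finset.mem_union.1 hv' with h | h
    · exact hvA h
    · obtain ⟨-, q, hq, hqw, hqv⟩ := hmB h
      rcases eq_or_adj_of_mem_closedNeighborFinset hG hf hd hq hqw hi hqv hiv with rfl | h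
      · obtain ⟨w, hw, hw5⟩ := hqw
        exact hin w hw hw5
      · exact hin q h.symm hq
  have hrest : ∑ v ∈ Finset.univ \ (A ∪ B ∪ C), G.excess v ≤ 0 := by
    refine Finset.sum_nonpos fun v hv => ?_
    simp only [Finset.mem_sdiff, Finset.mem_univ, true_and, Finset.mem_union, not_or] at hv
    obtain ⟨⟨hvA, hvB⟩, hvC⟩ := hv
    have h6 := degree_le_six hf hd v
    have h6' : G.degree v ≠ 6 := fun h => hvA (mem_sixPart.2 ⟨v, h, .inl rfl⟩)
    have h5 : G.degree v ≠ 5 := fun h => by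
      by_cases hw : ∃ w, G.Adj v w ∧ G.degree w = 5
      · exact hvB (Finset.mem_biUnion.2 ⟨v, by simpa [clusterVertices] using ⟨h, hvA, hw⟩,
          mem_cluster.2 ⟨v, ⟨.inl rfl, h⟩, .inl rfl⟩⟩)
      · push Not at hw
        exact hvC (Finset.mem_biUnion.2 ⟨v, by simpa [isolatedFives] using ⟨h, hvA, hw⟩,
          mem_closedNeighborFinset.2 (.inl rfl)⟩)
    rw [excess]
    omega
  have h1 : ∑ v ∈ A, G.excess v ≤ 0 := sum_excess_sixPart hG hf hd
  have h2 : ∑ v ∈ B, G.excess v ≤ 0 := sum_excess_clusters hG hf hd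
  have h3 : ∑ v ∈ C, G.excess v ≤ 0 := sum_excess_isolatedFives hf hd
  rw [← Finset.sum_sdiff (Finset.subset_univ (A ∪ B ∪ C)), Finset.sum_union hBC,
    Finset.sum_union hAB]
  omega

end Discharging

end SimpleGraph

theorem lemma2 {V : Type*} [Fintype V] [DecidableEq V] (G : SimpleGraph V) [DecidableRel G.Adj]
    (hplanar : G.IsPlanar) (hfree : (SimpleGraph.doubleStar 2 4).Free G)
    (hdeg : 3 ≤ G.minDegree) :
    (G.edgeFinset.card : ℚ) = (⊤ : G.Subgraph).weight ∧
      (⊤ : G.Subgraph).weight ≤ 31 / 14 * (Fintype.card V : ℚ) := by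
  rw [SimpleGraph.weight_top]
  refine ⟨rfl, ?_⟩
  have h := SimpleGraph.sum_excess_nonpos hplanar hfree
    fun v => hdeg.trans (G.minDegree_le_degree v)
  rw [SimpleGraph.sum_excess, G.sum_degrees_eq_twice_card_edges, Finset.card_univ] at h
  have h' : (14 : ℚ) * G.edgeFinset.card ≤ 31 * Fintype.card V := by
    have : 14 * G.edgeFinset.card ≤ 31 * Fintype.card V := by omega
    exact_mod_cast this
  linarith
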